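/- Let $m\ge 2$ be an integer and let $0<\gamma<\lambda<1$ satisfy $\lambda>1/m$ and $\gamma\lambda<1/m$. Let $K_{\gamma,\lambda}\subset\mathbb{R}^2$ be the attractor (the unique nonempty compact set equal to the union of its images) of the iterated function system $$\phi_i(x,y)=(\gamma x+i,\ \lambda y+i),\qquad i=0,1,\dots,m-1,$$ and let $\nu_\lambda$ be the associated Bernoulli convolution, i.e. the law of the random sum $\sum_{k=0}^\infty d_k\lambda^k$, where the digits $d_k$ are independent and uniformly distributed on $\{0,1,\dots,m-1\}$; equivalently, $\nu_\lambda$ is the probability measure with $\nu_\lambda=\frac1m\sum_{i=0}^{m-1}\nu_\lambda\circ\psi_i^{-1}$, $\psi_i(x)=\lambda x+i$. For a linear map $T$ of $\mathbb{R}^n$ with singular values $\alpha_1\ge\dots\ge\alpha_n$, let $\varphi^s(T)=\alpha_1\cdots\alpha_r\,\alpha_{r+1}^{\,s-r}$ with $r=\lfloor s\rfloor$ if $0\le s<n$, and $\varphi^s(T)=|\det T|^{s/n}$ if $s\ge n$. The Falconer dimension of a finite family $(T_i)_{i\in I}$ of linear maps is $\inf\{s\ge 0:\sum_{k\ge 0}\sum_{w\in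 I^k}\varphi^s(T_{w_1}\cdots T_{w_k})<\infty\}$. Let $s$ be the Falconer dimension of $K_{\gamma,\lambda}$, that is, of the family consisting of the linear parts of $\phi_0,\dots,\phi_{m-1}$ (each equal to $\mathrm{diag}(\gamma,\lambda)$); explicitly, $s=1+\log(m\lambda)/\log(1/\gamma)$. Assume the strong separation condition: the sets $\phi_i(K_{\gamma,\lambda})$, $0\le i\le m-1$, are pairwise disjoint. Then the $s$-dimensional Hausdorff measure satisfies $\mathcal{H}^s(K_{\gamma,\lambda})>0$ if and only if $\nu_\lambda$ is absolutely continuous with respect to Lebesgue measure with a bounded density. -/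

import Mathlib

open MeasureTheory Set

noncomputable section

/-! ### Attractors -/

/-- `A` is the attractor of the iterated function system `f`: the nonempty compact set that is the
union of its images under the maps of the system. -/
def IsAttractor {X ι : Type*} [TopologicalSpace X] (f : ι → X → X) (A : Set X) : Prop :=
  A.Nonempty ∧ IsCompact A ∧ A = ⋃ i, f i '' A

/-- The strong separation condition for an iterated function system `f` with attractor `A`: the
first-level pieces `f i '' A` are pairwise disjoint. -/
def StrongSeparation {X ι : Type*} (f : ι → X → X) (A : Set X) : Prop :=
  Pairwise fun i j => Disjoint (f i '' A) (f j '' A)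

/-! ### Falconer dimension -/

/-- Falconer's singular value function `φ^s(T)`. With `σ₀ ≥ σ₁ ≥ ⋯ ≥ σ_{n-1}` the singular values
of the endomorphism `T` of an `n`-dimensional Euclidean space, it is
`σ₀ ⋯ σ_{r-1} σ_r ^ (s - r)`, `r = ⌊s⌋`, for `0 ≤ s < n`, and `|det T| ^ (s / n)` for `s ≥ n`. -/
def singularValueFunction {E : Type*} [NormedAddCommGroup E] [InnerProductSpace ℝ E]
    [FiniteDimensional ℝ E] (s : ℝ) (T : Module.End ℝ E) : ℝ :=
  if s < Module.finrank ℝ E then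
    (∏ i ∈ Finset.range ⌊s⌋₊, LinearMap.singularValues T i) *
      LinearMap.singularValues T ⌊s⌋₊ ^ (s - ⌊s⌋₊)
  else |LinearMap.det T| ^ (s / Module.finrank ℝ E)

/-- The Falconer dimension of a finite family `T` of linear endomorphisms: the infimum of the
`s ≥ 0` such that `∑_k ∑_{|w| = k} φ^s(T_{w₀} ∘ ⋯ ∘ T_{w_{k-1}})` converges. -/
def falconerDimension {ι : Type*} [Fintype ι] {E : Type*} [NormedAddCommGroup E]
    [InnerProductSpace ℝ E] [FiniteDimensional ℝ E] (T : ι → Module.End ℝ E) : ℝ :=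
  sInf {s : ℝ | 0 ≤ s ∧ Summable fun k : ℕ =>
    ∑ w : Fin k → ι, singularValueFunction s (List.ofFn fun j => T (w j)).prod}

/-! ### The self-affine sets `K_{γ,λ}` for the digits `0, 1, …, m - 1` -/

/-- The linear map of the plane with matrix `diag(γ, lam)`. -/
def diagMap (γ lam : ℝ) : Module.End ℝ (EuclideanSpace ℝ (Fin 2)) :=
  Matrix.toEuclideanLin !![γ, 0; 0, lam]

/-- The maps `φ_i(x, y) = (γ x + i, lam y + i)`, `i = 0, …, m - 1`. -/
def affineIFS (m : ℕ) (γ lam : ℝ) (i : Fin m) (x : EuclideanSpace ℝ (Fin 2)) :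
    EuclideanSpace ℝ (Fin 2) :=
  diagMap γ lam x + !₂[((i : ℕ) : ℝ), ((i : ℕ) : ℝ)]

/-- The projection `Π_r(ω) = ∑_k ω_k r^k` of a sequence of digits. -/
def digitSum {m : ℕ} (r : ℝ) (ω : ℕ → Fin m) : ℝ := ∑' k, ((ω k : ℕ) : ℝ) * r ^ k

/-- The set `K_{γ,λ}` of all points `(∑ ω_k γ^k, ∑ ω_k lam^k)` with digits `ω_k`. By
`isAttractor_affineIFS_iff` below it is the attractor of the system `affineIFS m γ lam`. -/
def selfAffineSet (m : ℕ) (γ lam : ℝ) : Set (EuclideanSpace ℝ (Fin 2)) :=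
  range fun ω : ℕ → Fin m => !₂[digitSum γ ω, digitSum lam ω]

/-! ### The Bernoulli convolution `ν_λ` for the digits `0, 1, …, m - 1` -/

/-- The uniform Bernoulli measure `(1/m, …, 1/m)^ℕ` on sequences of digits. -/
def uniformBernoulli (m : ℕ) : Measure (ℕ → Fin m) :=
  Measure.infinitePi fun _ => ProbabilityTheory.uniformOn (univ : Set (Fin m))

/-- The Bernoulli convolution `ν_λ`: the law of `∑ ω_k lam^k` for independent digits `ω_k`,
uniformly distributed on `0, …, m - 1`. -/
def bernoulliConvolution (m : ℕ) (lam : ℝ) : Measure ℝ :=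
  (uniformBernoulli m).map (digitSum lam)

/-- `ν` is absolutely continuous with respect to Lebesgue measure, and its density is
(essentially) bounded. -/
def IsACWithBoundedDensity (ν : Measure ℝ) : Prop :=
  ν ≪ volume ∧ ∃ C : NNReal, ∀ᵐ x ∂(volume : Measure ℝ), ν.rnDeriv volume x ≤ C

/-! ### The definitions above have their defining properties -/

theorem digit_abs_le {m : ℕ} (i : Fin m) : |((i : ℕ) : ℝ)| ≤ m := by
  rw [abs_of_nonneg (by positivity)]
  exact_mod_cast i.2.le

theorem norm_digit_mul_le {m : ℕ} {r : ℝ} (h0 : 0 ≤ r) (i : Fin m) (k : ℕ) :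
    ‖((i : ℕ) : ℝ) * r ^ k‖ ≤ m * r ^ k := by
  rw [norm_mul, Real.norm_eq_abs, Real.norm_eq_abs, abs_of_nonneg (pow_nonneg h0 k)]
  exact mul_le_mul_of_nonneg_right (digit_abs_le i) (pow_nonneg h0 k)

theorem summable_digit {m : ℕ} {r : ℝ} (h0 : 0 ≤ r) (h1 : r < 1) (ω : ℕ → Fin m) :
    Summable fun k => ((ω k : ℕ) : ℝ) * r ^ k :=
  Summable.of_norm_bounded ((summable_geometric_of_lt_one h0 h1).mul_left (m : ℝ))
    fun k => norm_digit_mul_le h0 (ω k) k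

theorem continuous_digitSum {m : ℕ} {r : ℝ} (h0 : 0 ≤ r) (h1 : r < 1) :
    Continuous (digitSum r : (ℕ → Fin m) → ℝ) := by
  refine continuous_tsum (fun k => ?_) ((summable_geometric_of_lt_one h0 h1).mul_left (m : ℝ))
    fun k ω => norm_digit_mul_le h0 (ω k) k
  have : Continuous fun i : Fin m => ((i : ℕ) : ℝ) * r ^ k := continuous_of_discreteTopology
  exact this.comp (continuous_apply k)

theorem digitSum_eq {m : ℕ} {r : ℝ} (h0 : 0 ≤ r) (h1 : r < 1) (ω : ℕ → Fin m) :
    digitSum r ω = r * digitSum r (fun k => ω (k + 1)) + ((ω 0 : ℕ) : ℝ) := by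
  unfold digitSum
  rw [(summable_digit h0 h1 ω).tsum_eq_zero_add, ← tsum_mul_left, add_comm]
  congr 1
  · exact tsum_congr fun k => by ring
  · simp

theorem affineIFS_eq (m : ℕ) (γ lam : ℝ) (i : Fin m) (x : EuclideanSpace ℝ (Fin 2)) :
    affineIFS m γ lam i x =
      !₂[γ * x 0 + ((i : ℕ) : ℝ), lam * x 1 + ((i : ℕ) : ℝ)] := by
  ext j
  fin_cases j <;> simp [affineIFS, diagMap, Matrix.toLpLin_apply, dotProduct]

theorem eq_digitSum_of_orbit {m : ℕ} {r : ℝ} (h0 : 0 ≤ r) (h1 : r < 1) (ω : ℕ → Fin m)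
    (y : ℕ → ℝ) (C : ℝ) (hC : ∀ k, |y k| ≤ C)
    (hy : ∀ k, y k = r * y (k + 1) + ((ω k : ℕ) : ℝ)) : y 0 = digitSum r ω := by
  have key : ∀ n, y 0 - r ^ n * y n = ∑ k ∈ Finset.range n, ((ω k : ℕ) : ℝ) * r ^ k := by
    intro n
    induction n with
    | zero => simp
    | succ n ih => rw [Finset.sum_range_succ, ← ih, hy n]; ring
  have ht : Filter.Tendsto (fun n => r ^ n * y n) Filter.atTop (nhds 0) := by
    refine squeeze_zero_norm (a := fun n => r ^ n * C) (fun n => ?_) ?_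
    · rw [norm_mul, Real.norm_eq_abs, Real.norm_eq_abs, abs_of_nonneg (pow_nonneg h0 n)]
      exact mul_le_mul_of_nonneg_left (hC n) (pow_nonneg h0 n)
    · simpa using (tendsto_pow_atTop_nhds_zero_of_lt_one h0 h1).mul_const C
  have h2 := (summable_digit h0 h1 ω).hasSum.tendsto_sum_nat
  have h3 : Filter.Tendsto (fun n => y 0 - r ^ n * y n) Filter.atTop (nhds (y 0)) := by
    simpa using ht.const_sub (y 0)
  simp only [key] at h3
  exact tendsto_nhds_unique h3 h2

/-- `selfAffineSet m γ lam` is the attractor of `affineIFS m γ lam`, and the only one. -/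
theorem isAttractor_affineIFS_iff {m : ℕ} (hm : 0 < m) {γ lam : ℝ} (hγ0 : 0 ≤ γ) (hγ1 : γ < 1)
    (hl0 : 0 ≤ lam) (hl1 : lam < 1) (A : Set (EuclideanSpace ℝ (Fin 2))) :
    IsAttractor (affineIFS m γ lam) A ↔ A = selfAffineSet m γ lam := by
  constructor
  · rintro ⟨⟨a, ha⟩, hA, hinv⟩
    have hmem : ∀ i, ∀ x ∈ A, affineIFS m γ lam i x ∈ A := by
      intro i x hx
      rw [hinv]
      exact mem_iUnion.2 ⟨i, mem_image_of_mem _ hx⟩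
    apply Subset.antisymm
    · intro x hx
      have hstep : ∀ p : A, ∃ q : Fin m × A, affineIFS m γ lam q.1 q.2 = p := by
        rintro ⟨p, hp⟩
        have hp' := hp
        rw [hinv] at hp'
        obtain ⟨i, q, hq, rfl⟩ := mem_iUnion.1 hp'
        exact ⟨(i, ⟨q, hq⟩), rfl⟩
      choose f hf using hstep
      let z : ℕ → A := fun n => (fun p => (f p).2)^[n] ⟨x, hx⟩
      have hs : ∀ k, z (k + 1) = (f (z k)).2 := fun k => Function.iterate_succ_apply' _ _ _
      have hz : ∀ k, (z k : EuclideanSpace ℝ (Fin 2)) =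
          affineIFS m γ lam (f (z k)).1 (z (k + 1)) := fun k => by
        rw [hs k, hf]
      obtain ⟨C, hC⟩ := hA.isBounded.exists_norm_le
      have hb : ∀ (j : Fin 2) (k : ℕ), |(z k : EuclideanSpace ℝ (Fin 2)) j| ≤ C := fun j k =>
        (PiLp.norm_apply_le (z k : EuclideanSpace ℝ (Fin 2)) j).trans (hC _ (z k).2)
      have e0 := eq_digitSum_of_orbit hγ0 hγ1 (fun k => (f (z k)).1)
        (fun k => (z k : EuclideanSpace ℝ (Fin 2)) 0) C (hb 0) (fun k => by
          conv_lhs => rw [hz k, affineIFS_eq]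
          simp)
      have e1 := eq_digitSum_of_orbit hl0 hl1 (fun k => (f (z k)).1)
        (fun k => (z k : EuclideanSpace ℝ (Fin 2)) 1) C (hb 1) (fun k => by
          conv_lhs => rw [hz k, affineIFS_eq]
          simp)
      refine ⟨fun k => (f (z k)).1, ?_⟩
      ext j
      fin_cases j
      · exact e0.symm
      · exact e1.symm
    · rintro _ ⟨ω, rfl⟩
      have hn : ∀ (n : ℕ) (ω : ℕ → Fin m),
          !₂[γ ^ n * a 0 + ∑ k ∈ Finset.range n, ((ω k : ℕ) : ℝ) * γ ^ k,
            lam ^ n * a 1 + ∑ k ∈ Finset.range n, ((ω k : ℕ) : ℝ) * lam ^ k] ∈ A := by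
        intro n
        induction n with
        | zero =>
          intro ω
          convert! ha using 1
          ext j
          fin_cases j <;> simp
        | succ n ih =>
          intro ω
          convert! hmem (ω 0) _ (ih fun k => ω (k + 1)) using 1
          rw [affineIFS_eq]
          have aux : ∀ r t : ℝ,
              r ^ (n + 1) * t + ∑ k ∈ Finset.range (n + 1), ((ω k : ℕ) : ℝ) * r ^ k =
              r * (r ^ n * t + ∑ k ∈ Finset.range n, ((ω (k + 1) : ℕ) : ℝ) * r ^ k) +
                ((ω 0 : ℕ) : ℝ) := by
            intro r t
            rw [Finset.sum_range_succ', mul_add, Finset.mul_sum]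
            have : ∀ k, r * (((ω (k + 1) : ℕ) : ℝ) * r ^ k) =
              ((ω (k + 1) : ℕ) : ℝ) * r ^ (k + 1) := fun k => by ring
            simp only [this]
            ring
          ext j
          fin_cases j
          · exact aux γ (a 0)
          · exact aux lam (a 1)
      have hlim : ∀ (r t : ℝ), 0 ≤ r → r < 1 → Filter.Tendsto
          (fun n => r ^ n * t + ∑ k ∈ Finset.range n, ((ω k : ℕ) : ℝ) * r ^ k)
          Filter.atTop (nhds (digitSum r ω)) := by
        intro r t h0 h1
        simpa [digitSum] using ((tendsto_pow_atTop_nhds_zero_of_lt_one h0 h1).mul_const t).add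
          (summable_digit h0 h1 ω).hasSum.tendsto_sum_nat
      refine hA.isClosed.mem_of_tendsto (b := Filter.atTop) ?_
        (Filter.Eventually.of_forall fun n => hn n ω)
      refine ((PiLp.continuous_toLp 2 fun _ : Fin 2 => ℝ).tendsto _).comp ?_
      rw [tendsto_pi_nhds]
      intro j
      fin_cases j
      · exact hlim γ (a 0) hγ0 hγ1
      · exact hlim lam (a 1) hl0 hl1
  · rintro rfl
    refine ⟨⟨_, ⟨fun _ => ⟨0, hm⟩, rfl⟩⟩, ?_, ?_⟩
    · refine isCompact_range ((PiLp.continuous_toLp 2 fun _ : Fin 2 => ℝ).comp ?_)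
      refine continuous_pi fun j => ?_
      fin_cases j
      · exact continuous_digitSum hγ0 hγ1
      · exact continuous_digitSum hl0 hl1
    · have hcode : ∀ ω : ℕ → Fin m, !₂[digitSum γ ω, digitSum lam ω] =
          affineIFS m γ lam (ω 0)
            !₂[digitSum γ fun k => ω (k + 1), digitSum lam fun k => ω (k + 1)] := by
        intro ω
        rw [affineIFS_eq, digitSum_eq hγ0 hγ1 ω, digitSum_eq hl0 hl1 ω]
        rfl
      apply Subset.antisymm
      · rintro _ ⟨ω, rfl⟩
        exact mem_iUnion.2 ⟨ω 0, _, ⟨fun k => ω (k + 1), rfl⟩, (hcode ω).symm⟩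
      · intro x hx
        obtain ⟨i, _, ⟨ω, rfl⟩, rfl⟩ := mem_iUnion.1 hx
        let ω' : ℕ → Fin m := fun k => Nat.casesOn k i ω
        exact ⟨ω', hcode ω'⟩

theorem isProbabilityMeasure_uniformDigit {m : ℕ} (hm : 0 < m) :
    IsProbabilityMeasure (ProbabilityTheory.uniformOn (univ : Set (Fin m))) := by
  have : NeZero m := ⟨hm.ne'⟩
  exact ProbabilityTheory.isProbabilityMeasure_uniformOn finite_univ univ_nonempty

theorem isProbabilityMeasure_bernoulliConvolution {m : ℕ} (hm : 0 < m) {lam : ℝ} (h0 : 0 ≤ lam)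
    (h1 : lam < 1) : IsProbabilityMeasure (bernoulliConvolution m lam) := by
  have := isProbabilityMeasure_uniformDigit hm
  have : IsProbabilityMeasure (uniformBernoulli m) := by
    unfold uniformBernoulli; infer_instance
  exact Measure.isProbabilityMeasure_map (continuous_digitSum h0 h1).measurable.aemeasurable

/-- The sequence `i, ω 0, ω 1, …`. -/
def consDigit {m : ℕ} (i : Fin m) (ω : ℕ → Fin m) (k : ℕ) : Fin m := Nat.casesOn k i ω

theorem measurable_consDigit {m : ℕ} (i : Fin m) : Measurable (consDigit i) := by
  refine measurable_pi_lambda _ fun k => ?_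
  cases k with
  | zero => exact measurable_const
  | succ k => exact measurable_pi_apply k

theorem uniformBernoulli_eq_sum {m : ℕ} (hm : 0 < m) :
    uniformBernoulli m = ∑ i : Fin m, (m : ENNReal)⁻¹ • (uniformBernoulli m).map (consDigit i) := by
  have := isProbabilityMeasure_uniformDigit hm
  symm
  refine Measure.eq_infinitePi _ fun s t _ => ?_
  classical
  obtain ⟨N, hN⟩ : ∃ N, s ⊆ Finset.range (N + 1) :=
    ⟨s.sup id, fun k hk => Finset.mem_range.2 (Nat.lt_succ_of_le (Finset.le_sup (f := id) hk))⟩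
  let t' : ℕ → Set (Fin m) := fun k => if k ∈ s then t k else univ
  have hpi : Set.pi (s : Set ℕ) t = Set.pi (Finset.range (N + 1) : Set ℕ) t' := by
    ext ω
    simp only [Set.mem_pi, Finset.mem_coe]
    refine ⟨fun h k _ => ?_, fun h k hk => ?_⟩
    · by_cases hk : k ∈ s
      · simpa [t', hk] using h k hk
      · simp [t', hk]
    · simpa [t', hk] using h k (hN hk)
  have hprod : ∏ k ∈ s, ProbabilityTheory.uniformOn (univ : Set (Fin m)) (t k) =
      ∏ k ∈ Finset.range (N + 1), ProbabilityTheory.uniformOn (univ : Set (Fin m)) (t' k) := by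
    rw [← Finset.prod_subset hN fun k _ hk => by simp [t', hk]]
    exact Finset.prod_congr rfl fun k hk => by simp [t', hk]
  have hpre : ∀ i : Fin m, consDigit i ⁻¹' Set.pi (Finset.range (N + 1) : Set ℕ) t' =
      if i ∈ t' 0 then Set.pi (Finset.range N : Set ℕ) (fun k => t' (k + 1)) else ∅ := by
    intro i
    ext ω
    have : ω ∈ consDigit i ⁻¹' Set.pi (Finset.range (N + 1) : Set ℕ) t' ↔
        i ∈ t' 0 ∧ ∀ k < N, ω k ∈ t' (k + 1) := by
      simp only [mem_preimage, Set.mem_pi, Finset.mem_coe, Finset.mem_range]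
      refine ⟨fun h => ⟨h 0 (by omega), fun k hk => h (k + 1) (by omega)⟩, fun h k hk => ?_⟩
      cases k with
      | zero => exact h.1
      | succ k => exact h.2 k (by omega)
    rw [this]
    split_ifs with hi <;> simp [hi, Set.mem_pi]
  rw [hpi, hprod, Finset.prod_range_succ', Measure.finsetSum_apply]
  have hm' : MeasurableSet (Set.pi (Finset.range (N + 1) : Set ℕ) t') :=
    MeasurableSet.pi (Finset.countable_toSet _) fun _ _ => MeasurableSet.of_discrete
  have hterm : ∀ i : Fin m, ((m : ENNReal)⁻¹ • (uniformBernoulli m).map (consDigit i))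
      (Set.pi (Finset.range (N + 1) : Set ℕ) t') = (m : ENNReal)⁻¹ * (if i ∈ t' 0 then
        ∏ k ∈ Finset.range N, ProbabilityTheory.uniformOn (univ : Set (Fin m)) (t' (k + 1))
        else 0) := by
    intro i
    rw [Measure.smul_apply, Measure.map_apply (measurable_consDigit i) hm', hpre, smul_eq_mul]
    congr 1
    split_ifs
    · exact Measure.infinitePi_pi _ fun _ _ => MeasurableSet.of_discrete
    · simp
  rw [Finset.sum_congr rfl fun i _ => hterm i, ← Finset.mul_sum, ← Finset.sum_filter,
    Finset.sum_const, nsmul_eq_mul, ProbabilityTheory.uniformOn_univ, Fintype.card_fin,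
    Measure.count_apply MeasurableSet.of_discrete, Set.encard_eq_coe_toFinset_card,
    div_eq_mul_inv]
  simp only [Set.toFinset_card, Fintype.card_subtype, ENat.toENNReal_coe]
  ring

/-- The Bernoulli convolution satisfies its self-similarity relation. -/
theorem bernoulliConvolution_eq_sum {m : ℕ} (hm : 0 < m) {lam : ℝ} (h0 : 0 ≤ lam) (h1 : lam < 1) :
    bernoulliConvolution m lam = ∑ i : Fin m,
      (m : ENNReal)⁻¹ • (bernoulliConvolution m lam).map fun x => lam * x + ((i : ℕ) : ℝ) := by
  have hd : Measurable (digitSum lam : (ℕ → Fin m) → ℝ) := (continuous_digitSum h0 h1).measurable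
  conv_lhs => rw [bernoulliConvolution, uniformBernoulli_eq_sum hm]
  rw [Measure.map_finset_sum hd.aemeasurable]
  refine Finset.sum_congr rfl fun i _ => ?_
  rw [Measure.map_smul, bernoulliConvolution, Measure.map_map hd (measurable_consDigit i),
    Measure.map_map (by fun_prop) hd]
  congr 2
  funext ω
  exact digitSum_eq h0 h1 (consDigit i ω)

end

/-! Write `K` for `selfAffineSet m γ lam`, `μ` for `uniformBernoulli m`, `ν` for
`bernoulliConvolution m lam`. The singular values of `diag(γ, lam)^k` are `lam^k ≥ γ^k`, so for
exponents in `[1, 2)` Falconer's series is geometric with ratio `m * lam * γ^(t-1)`, and its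
critical exponent `s` solves `m * lam * γ^(s-1) = 1` (`falconerDimension_diagMap`).

Strong separation makes the coding map injective, and points at distance less than `d * γ^n` share
their first `n` digits (`mem_cylinder_of_dist_coding_lt`). A level-`n` cylinder is a copy of `K`
scaled by `γ^n` and `lam^n`; the part of it of diameter about `γ^n` is seen by `ν` at scale
`(γ/lam)^n`.

If `ν ≤ C * volume`, a set of diameter `r ~ γ^n` has mass at most about `m^(-n) * C * r / lam^n ~
r^s`, and the mass distribution principle gives positive measure
(`hausdorffMeasure_pos_of_le_smul`).

Conversely, let `h = H^s(K) > 0`. Covering by approximate squares shows `h < ∞`, and translation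
invariance then forces `H^s` on `K` to be `h` times the image of `μ`. Let `E n` be the sequences
falling in cells of mesh `(γ/lam)^n` where `ν` has average density above `C`. These cells have total
length at most `μ(E n) / C`, so `E n` is cheap to cover: for suitable `C` the pre-measure of `K` at
scale `~ γ^n` is at most `h - (h/2) * μ(E n)`. Pre-measures tend to `h`, hence `μ(E n) → 0`, and in
the limit `ν ≤ C * volume` (`exists_bernoulliConvolution_le_smul`). -/

noncomputable section

/-! ### Singular values of diagonal maps and the Falconer dimension -/

theorem diagMap_mul (a b c d : ℝ) : diagMap a b * diagMap c d = diagMap (a * c) (b * d) := by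
  ext x j
  fin_cases j <;> simp [diagMap, Matrix.toLpLin_apply, dotProduct] <;> ring

theorem diagMap_one : diagMap 1 1 = 1 := by
  ext x j
  fin_cases j <;> simp [diagMap, Matrix.toLpLin_apply, dotProduct]

theorem diagMap_pow (a b : ℝ) (n : ℕ) : diagMap a b ^ n = diagMap (a ^ n) (b ^ n) := by
  induction n with
  | zero => simp [diagMap_one]
  | succ n ih => rw [pow_succ, ih, diagMap_mul, pow_succ, pow_succ]

theorem adjoint_diagMap (a b : ℝ) : LinearMap.adjoint (diagMap a b) = diagMap a b := by
  rw [diagMap, ← Matrix.toEuclideanLin_conjTranspose_eq_adjoint]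
  congr 1
  ext i j
  fin_cases i <;> fin_cases j <;> simp

theorem det_diagMap (a b : ℝ) : LinearMap.det (diagMap a b) = a * b := by
  rw [diagMap, Matrix.toEuclideanLin_eq_toLin_orthonormal, LinearMap.det_toLin, Matrix.det_fin_two_of]
  ring

theorem trace_diagMap (a b : ℝ) : LinearMap.trace ℝ _ (diagMap a b) = a + b := by
  rw [diagMap, Matrix.toEuclideanLin_eq_toLin_orthonormal, Matrix.trace_toLin_eq, Matrix.trace_fin_two_of]

/-- Trace and determinant of `T* T` give the sum and the product of the squared singular values;
with the ordering these determine both. -/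
theorem singularValues_diagMap {a b : ℝ} (ha : 0 ≤ a) (hab : a ≤ b) :
    (diagMap a b).singularValues 0 = b ∧ (diagMap a b).singularValues 1 = a := by
  have hf : Module.finrank ℝ (EuclideanSpace ℝ (Fin 2)) = 2 := by simp
  have hT := (diagMap a b).isSymmetric_adjoint_comp_self
  have hc : LinearMap.adjoint (diagMap a b) ∘ₗ diagMap a b = diagMap (a * a) (b * b) := by
    rw [adjoint_diagMap]; exact diagMap_mul a b a b
  have hd := (congrArg LinearMap.det hc).symm.trans (hT.det_eq_prod_eigenvalues hf)
  have ht := (congrArg (LinearMap.trace ℝ _) hc).symm.trans (hT.trace_eq_sum_eigenvalues hf)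
  have h0 := (diagMap a b).sq_singularValues_fin hf 0
  have h1 := (diagMap a b).sq_singularValues_fin hf 1
  rw [det_diagMap] at hd
  rw [trace_diagMap] at ht
  simp only [Fin.prod_univ_two, Fin.sum_univ_two, RCLike.ofReal_real_eq_id, id] at hd ht
  rw [← h0, ← h1] at hd ht
  have hanti := (diagMap a b).singularValues_antitone (zero_le_one : (0 : ℕ) ≤ 1)
  have p0 := (diagMap a b).singularValues_nonneg 0
  have p1 := (diagMap a b).singularValues_nonneg 1
  have e0 : ((0 : Fin 2) : ℕ) = 0 := rfl
  have e1 : ((1 : Fin 2) : ℕ) = 1 := rfl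
  rw [e0, e1] at hd ht
  generalize (diagMap a b).singularValues 0 = u at *
  generalize (diagMap a b).singularValues 1 = v at *
  have huv : u * v = a * b := by
    have : (u * v) ^ 2 = (a * b) ^ 2 := by linarith
    exact (sq_eq_sq₀ (by positivity) (by nlinarith)).1 this
  have hs : u + v = a + b := (sq_eq_sq₀ (by positivity) (by linarith)).1 (by nlinarith)
  have hdif : u - v = b - a := (sq_eq_sq₀ (by linarith) (by linarith)).1 (by nlinarith)
  constructor <;> linarith

theorem singularValueFunction_diagMap_of_lt_one {a b t : ℝ} (ha : 0 ≤ a) (hab : a ≤ b)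
    (ht1 : t < 1) : singularValueFunction t (diagMap a b) = b ^ t := by
  have hfl : ⌊t⌋₊ = 0 := Nat.floor_eq_zero.2 ht1
  have h2 : t < 2 := by linarith
  simp [singularValueFunction, hfl, h2, singularValues_diagMap ha hab]

theorem singularValueFunction_diagMap_of_lt_two {a b t : ℝ} (ha : 0 ≤ a) (hab : a ≤ b)
    (ht1 : 1 ≤ t) (ht2 : t < 2) :
    singularValueFunction t (diagMap a b) = b * a ^ (t - 1) := by
  have hfl : ⌊t⌋₊ = 1 := (Nat.floor_eq_iff (by linarith)).2 (by norm_num; constructor <;> linarith)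
  simp [singularValueFunction, hfl, ht2, singularValues_diagMap ha hab]

/-- The exponent `s` with `m * lam * γ ^ (s - 1) = 1`. -/
def criticalExponent (m : ℕ) (γ lam : ℝ) : ℝ := 1 + Real.log (m * lam) / Real.log (1 / γ)

theorem mul_rpow_criticalExponent {m : ℕ} {γ lam : ℝ} (hγ : 0 < γ) (hγ1 : γ < 1)
    (h : 0 < m * lam) : m * lam * γ ^ (criticalExponent m γ lam - 1) = 1 := by
  have hl : Real.log γ < 0 := Real.log_neg hγ hγ1
  have : γ ^ (criticalExponent m γ lam - 1) = (m * lam)⁻¹ := by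
    rw [Real.rpow_def_of_pos hγ, criticalExponent, one_div, Real.log_inv,
      show Real.log γ * (1 + Real.log (m * lam) / -Real.log γ - 1) = -Real.log (m * lam) by
        have := hl.ne
        field_simp
        ring, Real.exp_neg, Real.exp_log h]
  rw [this, mul_inv_cancel₀ h.ne']

theorem one_lt_criticalExponent {m : ℕ} {γ lam : ℝ} (hγ : 0 < γ) (hγ1 : γ < 1)
    (h : 1 < m * lam) : 1 < criticalExponent m γ lam := by
  have : 0 < Real.log (m * lam) / Real.log (1 / γ) :=
    div_pos (Real.log_pos h) (Real.log_pos (by rw [lt_div_iff₀ hγ]; linarith))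
  unfold criticalExponent; linarith

theorem criticalExponent_lt_two {m : ℕ} {γ lam : ℝ} (hγ : 0 < γ) (hγ1 : γ < 1)
    (h : 0 < m * lam) (h' : m * lam * γ < 1) : criticalExponent m γ lam < 2 := by
  have : Real.log (m * lam) / Real.log (1 / γ) < 1 := by
    rw [div_lt_one (Real.log_pos (by rw [lt_div_iff₀ hγ]; linarith))]
    exact Real.log_lt_log h (by rw [lt_div_iff₀ hγ]; linarith)
  unfold criticalExponent; linarith

theorem sum_singularValueFunction_diagMap (m : ℕ) (γ lam t : ℝ) (k : ℕ) :
    ∑ w : Fin k → Fin m, singularValueFunction t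
      (List.ofFn fun j => (fun _ : Fin m => diagMap γ lam) (w j)).prod =
      (m : ℝ) ^ k * singularValueFunction t (diagMap (γ ^ k) (lam ^ k)) := by
  simp [List.ofFn_const, List.prod_replicate, diagMap_pow]

theorem falconerDimension_diagMap {m : ℕ} {γ lam : ℝ} (hγ : 0 < γ) (hγlam : γ < lam)
    (hlam : lam < 1) (hlarge : 1 < m * lam) (hprod : m * lam * γ < 1) :
    falconerDimension (fun _ : Fin m => diagMap γ lam) = criticalExponent m γ lam := by
  have hγ1 : γ < 1 := hγlam.trans hlam
  have hl0 : 0 < lam := hγ.trans hγlam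
  have hml : 0 < m * lam := by linarith
  have hle : ∀ k, γ ^ k ≤ lam ^ k := fun k => pow_le_pow_left₀ hγ.le hγlam.le k
  set s := criticalExponent m γ lam with hs
  have hs1 : 1 < s := one_lt_criticalExponent hγ hγ1 hlarge
  have hs2 : s < 2 := criticalExponent_lt_two hγ hγ1 hml hprod
  have hcrit : m * lam * γ ^ (s - 1) = 1 := mul_rpow_criticalExponent hγ hγ1 hml
  have hgeo : ∀ t, 1 ≤ t → t < 2 → ∀ k : ℕ,
      (m : ℝ) ^ k * singularValueFunction t (diagMap (γ ^ k) (lam ^ k)) =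
        (m * lam * γ ^ (t - 1)) ^ k := by
    intro t h1 h2 k
    rw [singularValueFunction_diagMap_of_lt_two (pow_nonneg hγ.le k) (hle k) h1 h2,
      ← Real.rpow_natCast, ← Real.rpow_natCast γ, ← Real.rpow_natCast lam, ← Real.rpow_mul hγ.le,
      mul_comm (k : ℝ), Real.rpow_mul hγ.le]
    simp only [Real.rpow_natCast, mul_pow, mul_assoc]
  have hsumm : ∀ t, s < t → t < 2 → Summable fun k : ℕ =>
      (m : ℝ) ^ k * singularValueFunction t (diagMap (γ ^ k) (lam ^ k)) := by
    intro t h1 h2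
    simp only [hgeo t (by linarith) h2]
    refine summable_geometric_of_lt_one (by positivity) ?_
    rw [← hcrit]
    exact mul_lt_mul_of_pos_left (Real.rpow_lt_rpow_of_exponent_gt hγ hγ1 (by linarith)) hml
  unfold falconerDimension
  simp only [sum_singularValueFunction_diagMap]
  apply le_antisymm
  · refine le_of_forall_gt_imp_ge_of_dense fun t ht => ?_
    rcases lt_or_ge t 2 with h2 | h2
    · refine csInf_le ⟨0, fun x hx => hx.1⟩ ⟨by linarith, hsumm _ (by linarith) h2⟩
    -- For `t ≥ 2` the midpoint of `s` and `2` serves as a smaller admissible exponent, which avoids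
    -- the determinant branch of `singularValueFunction`.
    · refine (csInf_le ⟨0, fun x hx => hx.1⟩
        (?_ : (s + 2) / 2 ∈ _)).trans (by linarith : (s + 2) / 2 ≤ t)
      exact ⟨by linarith, hsumm _ (by linarith) (by linarith)⟩
  · refine le_csInf ⟨(s + 2) / 2, by linarith, hsumm _ (by linarith) (by linarith)⟩ ?_
    rintro t ⟨ht0, hsum⟩
    by_contra! hts
    -- Below `s` no term drops under `1`, so the series cannot converge. For `t < 1` this uses `m *
    -- lam > 1`, for `t ≥ 1` the critical equation.
    have hbig : ∀ k : ℕ, 1 ≤ (m : ℝ) ^ k * singularValueFunction t (diagMap (γ ^ k) (lam ^ k)) := by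
      intro k
      rcases lt_or_ge t 1 with h1 | h1
      · rw [singularValueFunction_diagMap_of_lt_one (pow_nonneg hγ.le k) (hle k) h1]
        calc (1 : ℝ) ≤ (m * lam) ^ k := one_le_pow₀ hlarge.le
          _ = (m : ℝ) ^ k * (lam ^ k) ^ (1 : ℝ) := by rw [mul_pow, Real.rpow_one]
          _ ≤ _ := mul_le_mul_of_nonneg_left (Real.rpow_le_rpow_of_exponent_ge
              (pow_pos hl0 k) (pow_le_one₀ hl0.le hlam.le) h1.le) (by positivity)
      · rw [hgeo t h1 (by linarith)]
        refine one_le_pow₀ ?_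
        rw [← hcrit]
        exact mul_le_mul_of_nonneg_left
          (Real.rpow_le_rpow_of_exponent_ge hγ hγ1.le (by linarith)) hml.le
    have := ge_of_tendsto' hsum.tendsto_atTop_zero hbig
    linarith

/-! ### The uniform Bernoulli measure on sequences of digits -/

/-- The sequence `ω n, ω (n + 1), …`. -/
def shift {m : ℕ} (n : ℕ) (ω : ℕ → Fin m) (k : ℕ) : Fin m := ω (k + n)

theorem continuous_shift {m : ℕ} (n : ℕ) : Continuous (shift n : (ℕ → Fin m) → ℕ → Fin m) :=
  continuous_pi fun k => continuous_apply (k + n)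

theorem isProbabilityMeasure_uniformBernoulli {m : ℕ} (hm : 0 < m) :
    IsProbabilityMeasure (uniformBernoulli m) := by
  have := isProbabilityMeasure_uniformDigit hm
  unfold uniformBernoulli
  infer_instance

theorem shift_consDigit {m : ℕ} (n : ℕ) (i : Fin m) (ω : ℕ → Fin m) :
    shift (n + 1) (consDigit i ω) = shift n ω := rfl

theorem map_shift_uniformBernoulli {m : ℕ} (hm : 0 < m) (n : ℕ) :
    (uniformBernoulli m).map (shift n) = uniformBernoulli m := by
  induction n with
  | zero => exact Measure.map_id
  | succ n ih =>
    conv_lhs => rw [uniformBernoulli_eq_sum hm]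
    rw [Measure.map_finset_sum (continuous_shift _).measurable.aemeasurable]
    have : ∀ i : Fin m, ((m : ENNReal)⁻¹ • (uniformBernoulli m).map (consDigit i)).map
        (shift (n + 1)) = (m : ENNReal)⁻¹ • uniformBernoulli m := by
      intro i
      rw [Measure.map_smul, Measure.map_map (continuous_shift _).measurable
        (measurable_consDigit i)]
      exact congrArg _ ih
    rw [Finset.sum_congr rfl fun i _ => this i, Finset.sum_const, Finset.card_univ,
      Fintype.card_fin, ← Nat.cast_smul_eq_nsmul ENNReal, smul_smul,
      ENNReal.mul_inv_cancel (by simpa using hm.ne') (by simp), one_smul]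

theorem measurableSet_cylinder {m : ℕ} (x : ℕ → Fin m) (n : ℕ) :
    MeasurableSet (PiNat.cylinder x n) :=
  (PiNat.isOpen_cylinder _ x n).measurableSet

/-- The first `n` digits are independent of the later ones. -/
theorem uniformBernoulli_cylinder_inter_shift {m : ℕ} (hm : 0 < m) (n : ℕ) (x : ℕ → Fin m)
    {A : Set (ℕ → Fin m)} (hA : MeasurableSet A) :
    uniformBernoulli m (PiNat.cylinder x n ∩ shift n ⁻¹' A) =
      (m : ENNReal)⁻¹ ^ n * uniformBernoulli m A := by
  induction n generalizing x with
  | zero =>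
    rw [PiNat.cylinder_zero, univ_inter, pow_zero, one_mul]
    rfl
  | succ n ih =>
    have hmeas : MeasurableSet (PiNat.cylinder x (n + 1) ∩ shift (n + 1) ⁻¹' A) :=
      (measurableSet_cylinder x _).inter ((continuous_shift _).measurable hA)
    have hterm : ∀ i : Fin m, ((m : ENNReal)⁻¹ • (uniformBernoulli m).map (consDigit i))
        (PiNat.cylinder x (n + 1) ∩ shift (n + 1) ⁻¹' A) =
        if i = x 0 then (m : ENNReal)⁻¹ ^ (n + 1) * uniformBernoulli m A else 0 := by
      intro i
      rw [Measure.smul_apply, Measure.map_apply (measurable_consDigit i) hmeas, smul_eq_mul]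
      split_ifs with hi
      · have : consDigit i ⁻¹' (PiNat.cylinder x (n + 1) ∩ shift (n + 1) ⁻¹' A) =
            PiNat.cylinder (shift 1 x) n ∩ shift n ⁻¹' A := by
          ext ω
          simp only [mem_preimage, mem_inter_iff, shift_consDigit, and_congr_left_iff,
            PiNat.mem_cylinder_iff]
          intro _
          refine ⟨fun h k hk => h (k + 1) (by omega), fun h k hk => ?_⟩
          cases k with
          | zero => exact hi
          | succ k => exact h k (by omega)
        rw [this, ih, pow_succ', mul_assoc]
      · have : consDigit i ⁻¹' (PiNat.cylinder x (n + 1) ∩ shift (n + 1) ⁻¹' A) = ∅ := by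
          ext ω
          simp only [mem_preimage, mem_inter_iff, mem_empty_iff_false, iff_false, not_and]
          intro h
          exact absurd (PiNat.mem_cylinder_iff.1 h 0 (by omega)) hi
        rw [this, measure_empty, mul_zero]
    rw [uniformBernoulli_eq_sum hm, Measure.finsetSum_apply,
      Finset.sum_congr rfl fun i _ => hterm i, ← uniformBernoulli_eq_sum hm]
    simp

theorem uniformBernoulli_cylinder {m : ℕ} (hm : 0 < m) (n : ℕ) (x : ℕ → Fin m) :
    uniformBernoulli m (PiNat.cylinder x n) = (m : ENNReal)⁻¹ ^ n := by
  have := isProbabilityMeasure_uniformBernoulli hm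
  simpa using uniformBernoulli_cylinder_inter_shift hm n x MeasurableSet.univ

/-- Each cylinder splits into `m` cylinders of the next level, which carry equal mass. -/
theorem measure_cylinder_of_forall_eq {m : ℕ} (hm : 0 < m) {κ : Measure (ℕ → Fin m)}
    (hκ : ∀ x y n, κ (PiNat.cylinder x n) = κ (PiNat.cylinder y n)) (x : ℕ → Fin m) (n : ℕ) :
    κ (PiNat.cylinder x n) = κ univ * (m : ENNReal)⁻¹ ^ n := by
  induction n with
  | zero => simp
  | succ n ih =>
    rw [← PiNat.iUnion_cylinder_update, measure_iUnion _ fun k => measurableSet_cylinder _ _,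
      tsum_fintype, Finset.sum_congr rfl fun k _ => hκ _ x (n + 1), Finset.sum_const,
      Finset.card_univ, Fintype.card_fin, nsmul_eq_mul] at ih
    · rw [pow_succ, ← mul_assoc, ← ih, mul_comm, ← mul_assoc,
        ENNReal.inv_mul_cancel (by simpa using hm.ne') (by simp), one_mul]
    · intro i j hij
      refine disjoint_left.2 fun ω hi hj => hij ?_
      have h1 := PiNat.mem_cylinder_iff.1 hi n (by omega)
      have h2 := PiNat.mem_cylinder_iff.1 hj n (by omega)
      simpa [h1] using h2

theorem measure_ext_of_cylinder {m : ℕ} {κ κ' : Measure (ℕ → Fin m)} [IsFiniteMeasure κ]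
    (huniv : κ univ = κ' univ)
    (h : ∀ x n, κ (PiNat.cylinder x n) = κ' (PiNat.cylinder x n)) : κ = κ' := by
  have hb := PiNat.isTopologicalBasis_cylinders (E := fun _ : ℕ => Fin m)
  refine ext_of_generate_finite
    {s : Set (ℕ → Fin m) | ∃ (x : ℕ → Fin m) (n : ℕ), s = PiNat.cylinder x n} ?_ ?_ ?_ huniv
  · rw [← hb.borel_eq_generateFrom]
    exact BorelSpace.measurable_eq
  · rintro _ ⟨x, n, rfl⟩ _ ⟨y, k, rfl⟩ ⟨z, hz1, hz2⟩
    rw [← PiNat.mem_cylinder_iff_eq.1 hz1, ← PiNat.mem_cylinder_iff_eq.1 hz2]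
    rcases le_total n k with hnk | hnk
    · exact ⟨z, k, inter_eq_self_of_subset_right (PiNat.cylinder_anti z hnk)⟩
    · exact ⟨z, n, inter_eq_self_of_subset_left (PiNat.cylinder_anti z hnk)⟩
  · rintro _ ⟨x, n, rfl⟩
    exact h x n

theorem eq_smul_uniformBernoulli {m : ℕ} (hm : 0 < m) {κ : Measure (ℕ → Fin m)}
    [IsFiniteMeasure κ] (hκ : ∀ x y n, κ (PiNat.cylinder x n) = κ (PiNat.cylinder y n)) :
    κ = κ univ • uniformBernoulli m := by
  have := isProbabilityMeasure_uniformBernoulli hm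
  refine measure_ext_of_cylinder (by simp) fun x n => ?_
  rw [measure_cylinder_of_forall_eq hm hκ, Measure.smul_apply, uniformBernoulli_cylinder hm,
    smul_eq_mul]

/-! ### The coding map -/

/-- The coding map of the self-affine set `K_{γ,λ}`. -/
def coding {m : ℕ} (γ lam : ℝ) (ω : ℕ → Fin m) : EuclideanSpace ℝ (Fin 2) :=
  !₂[digitSum γ ω, digitSum lam ω]

theorem range_coding (m : ℕ) (γ lam : ℝ) :
    range (coding γ lam : (ℕ → Fin m) → _) = selfAffineSet m γ lam := rfl

theorem continuous_coding {m : ℕ} {γ lam : ℝ} (hγ0 : 0 ≤ γ) (hγ1 : γ < 1) (hl0 : 0 ≤ lam)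
    (hl1 : lam < 1) : Continuous (coding γ lam : (ℕ → Fin m) → _) := by
  refine (PiLp.continuous_toLp 2 fun _ : Fin 2 => ℝ).comp (continuous_pi fun j => ?_)
  fin_cases j
  · exact continuous_digitSum hγ0 hγ1
  · exact continuous_digitSum hl0 hl1

theorem digitSum_eq_sum_add {m : ℕ} {r : ℝ} (h0 : 0 ≤ r) (h1 : r < 1) (ω : ℕ → Fin m) (n : ℕ) :
    digitSum r ω = ∑ k ∈ Finset.range n, ((ω k : ℕ) : ℝ) * r ^ k +
      r ^ n * digitSum r (shift n ω) := by
  unfold digitSum shift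
  rw [← (summable_digit h0 h1 ω).sum_add_tsum_nat_add n, ← tsum_mul_left]
  congr 1
  exact tsum_congr fun k => by ring

theorem digitSum_sub_of_mem_cylinder {m : ℕ} {r : ℝ} (h0 : 0 ≤ r) (h1 : r < 1)
    {ω ω' : ℕ → Fin m} {n : ℕ} (h : ω ∈ PiNat.cylinder ω' n) :
    digitSum r ω - digitSum r ω' = r ^ n * (digitSum r (shift n ω) - digitSum r (shift n ω')) := by
  rw [digitSum_eq_sum_add h0 h1 ω n, digitSum_eq_sum_add h0 h1 ω' n,
    Finset.sum_congr rfl fun k hk => by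
      rw [PiNat.mem_cylinder_iff.1 h k (Finset.mem_range.1 hk)]]
  ring

theorem dist_coding {m : ℕ} (γ lam : ℝ) (ω ω' : ℕ → Fin m) :
    dist (coding γ lam ω) (coding γ lam ω') =
      √((digitSum γ ω - digitSum γ ω') ^ 2 + (digitSum lam ω - digitSum lam ω') ^ 2) := by
  simp [EuclideanSpace.dist_eq, Fin.sum_univ_two, coding, Real.dist_eq, sq_abs]

theorem abs_digitSum_sub_le_dist_coding {m : ℕ} (γ lam : ℝ) (ω ω' : ℕ → Fin m) :
    |digitSum lam ω - digitSum lam ω'| ≤ dist (coding γ lam ω) (coding γ lam ω') := by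
  rw [dist_coding]
  exact Real.abs_le_sqrt (by nlinarith [sq_nonneg (digitSum γ ω - digitSum γ ω')])

/-- Codings of sequences starting with different digits are uniformly separated. -/
theorem exists_le_dist_coding {m : ℕ} {γ lam : ℝ} (hγ0 : 0 ≤ γ) (hγ1 : γ < 1) (hl0 : 0 ≤ lam)
    (hl1 : lam < 1) (hsep : StrongSeparation (affineIFS m γ lam) (selfAffineSet m γ lam)) :
    ∃ d > 0, ∀ ω ω' : ℕ → Fin m, ω 0 ≠ ω' 0 → d ≤ dist (coding γ lam ω) (coding γ lam ω') := by
  let S : Set ((ℕ → Fin m) × (ℕ → Fin m)) := {p | p.1 0 ≠ p.2 0}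
  have hS : IsCompact S := by
    have : Continuous fun p : (ℕ → Fin m) × (ℕ → Fin m) => (p.1 0, p.2 0) := by fun_prop
    exact (IsClosed.preimage this (isClosed_discrete {q : Fin m × Fin m | q.1 ≠ q.2})).isCompact
  have hc := continuous_coding (m := m) hγ0 hγ1 hl0 hl1
  have hcont : Continuous fun p : (ℕ → Fin m) × (ℕ → Fin m) =>
      dist (coding γ lam p.1) (coding γ lam p.2) :=
    (hc.comp continuous_fst).dist (hc.comp continuous_snd)
  rcases S.eq_empty_or_nonempty with hE | hE
  -- With at most one digit there are no such pairs, and any positive constant will do. Otherwise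
  -- the distance attains its minimum on the compact set `S`, and separation makes that minimum
  -- positive.
  · exact ⟨1, one_pos, fun ω ω' h => absurd (show (ω, ω') ∈ S from h) (by simp [hE])⟩
  · obtain ⟨p, hp, hmin⟩ := hS.exists_isMinOn hE hcont.continuousOn
    refine ⟨dist (coding γ lam p.1) (coding γ lam p.2), dist_pos.2 fun heq => ?_,
      fun ω ω' h => isMinOn_iff.1 hmin (ω, ω') h⟩
    have hmem : ∀ ω : ℕ → Fin m,
        coding γ lam ω ∈ affineIFS m γ lam (ω 0) '' selfAffineSet m γ lam := by
      intro ω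
      refine ⟨coding γ lam (shift 1 ω), ⟨_, rfl⟩, ?_⟩
      rw [affineIFS_eq]
      unfold coding
      rw [digitSum_eq hγ0 hγ1 ω, digitSum_eq hl0 hl1 ω]
      rfl
    exact disjoint_left.1 (hsep hp) (hmem p.1) (heq ▸ hmem p.2)

/-- If the codings of two sequences are close, then the sequences agree for a long time. -/
theorem mem_cylinder_of_dist_coding_lt {m : ℕ} {γ lam : ℝ} (hγ0 : 0 < γ) (hγlam : γ < lam)
    (hl1 : lam < 1) {d : ℝ} (hd0 : 0 < d)
    (hd : ∀ ω ω' : ℕ → Fin m, ω 0 ≠ ω' 0 → d ≤ dist (coding γ lam ω) (coding γ lam ω')) (n : ℕ)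
    (ω ω' : ℕ → Fin m) (h : dist (coding γ lam ω) (coding γ lam ω') < d * γ ^ n) :
    ω ∈ PiNat.cylinder ω' n := by
  have hγ1 : γ < 1 := hγlam.trans hl1
  induction n generalizing ω ω' with
  | zero => simp
  | succ n ih =>
    have h0 : ω 0 = ω' 0 := by
      by_contra hne
      have h1 := hd ω ω' hne
      have : d * γ ^ (n + 1) ≤ d :=
        mul_le_of_le_one_right hd0.le (pow_le_one₀ hγ0.le hγ1.le)
      linarith
    have hcyl : ω ∈ PiNat.cylinder ω' 1 :=
      PiNat.mem_cylinder_iff.2 fun i hi => Nat.lt_one_iff.1 hi ▸ h0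
    -- Because `γ < lam`, a map of the system shrinks no distance by more than the factor `γ`.
    have hstep : γ * dist (coding γ lam (shift 1 ω)) (coding γ lam (shift 1 ω')) ≤
        dist (coding γ lam ω) (coding γ lam ω') := by
      rw [dist_coding, dist_coding, digitSum_sub_of_mem_cylinder hγ0.le hγ1 hcyl,
        digitSum_sub_of_mem_cylinder (hγ0.trans hγlam).le hl1 hcyl]
      refine Real.le_sqrt_of_sq_le ?_
      rw [mul_pow, Real.sq_sqrt (by positivity), pow_one, pow_one, mul_add, mul_pow, mul_pow]
      gcongr
    have := ih (shift 1 ω) (shift 1 ω') <| by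
      rw [pow_succ] at h
      nlinarith
    refine PiNat.mem_cylinder_iff.2 fun i hi => ?_
    cases i with
    | zero => exact h0
    | succ i => exact PiNat.mem_cylinder_iff.1 this i (by omega)

theorem injective_coding {m : ℕ} {γ lam : ℝ} (hγ0 : 0 < γ) (hγlam : γ < lam) (hl1 : lam < 1)
    (hsep : StrongSeparation (affineIFS m γ lam) (selfAffineSet m γ lam)) :
    Function.Injective (coding γ lam : (ℕ → Fin m) → _) := by
  intro ω ω' h
  obtain ⟨d, hd0, hd⟩ := exists_le_dist_coding hγ0.le (hγlam.trans hl1) (hγ0.trans hγlam).le hl1 hsep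
  funext k
  refine PiNat.mem_cylinder_iff.1
    (mem_cylinder_of_dist_coding_lt hγ0 hγlam hl1 hd0 hd (k + 1) ω ω' ?_) k (by omega)
  rw [h, dist_self]
  positivity

theorem measurableEmbedding_coding {m : ℕ} {γ lam : ℝ} (hγ0 : 0 < γ) (hγlam : γ < lam)
    (hl1 : lam < 1) (hsep : StrongSeparation (affineIFS m γ lam) (selfAffineSet m γ lam)) :
    MeasurableEmbedding (coding γ lam : (ℕ → Fin m) → _) :=
  ((continuous_coding hγ0.le (hγlam.trans hl1) (hγ0.trans hγlam).le hl1).isClosedEmbedding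
    (injective_coding hγ0 hγlam hl1 hsep)).measurableEmbedding

/-! ### Hausdorff measure on cylinders -/

/-- All linear parts are equal, so the images of two cylinders of the same level differ by a
translation. Only one inequality is needed, as `x` and `y` can be exchanged. -/
theorem hausdorffMeasure_image_cylinder_le {m : ℕ} {γ lam : ℝ} (hγ0 : 0 ≤ γ) (hγ1 : γ < 1)
    (hl0 : 0 ≤ lam) (hl1 : lam < 1) (s : ℝ) (x y : ℕ → Fin m) (n : ℕ) :
    Measure.hausdorffMeasure s (coding γ lam '' PiNat.cylinder x n) ≤
      Measure.hausdorffMeasure s (coding γ lam '' PiNat.cylinder y n) := by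
  let v : EuclideanSpace ℝ (Fin 2) :=
    !₂[∑ k ∈ Finset.range n, ((x k : ℕ) : ℝ) * γ ^ k, ∑ k ∈ Finset.range n, ((x k : ℕ) : ℝ) * lam ^ k]
      - !₂[∑ k ∈ Finset.range n, ((y k : ℕ) : ℝ) * γ ^ k,
        ∑ k ∈ Finset.range n, ((y k : ℕ) : ℝ) * lam ^ k]
  rw [← (IsometryEquiv.addLeft v).hausdorffMeasure_image s (coding γ lam '' PiNat.cylinder y n)]
  refine measure_mono ?_
  rintro _ ⟨ω, hω, rfl⟩
  let ω' : ℕ → Fin m := fun k => if k < n then y k else ω k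
  have hω' : ω' ∈ PiNat.cylinder y n := PiNat.mem_cylinder_iff.2 fun k hk => if_pos hk
  have hshift : shift n ω' = shift n ω := funext fun k => if_neg (by omega)
  have key : ∀ r : ℝ, 0 ≤ r → r < 1 → digitSum r ω =
      ∑ k ∈ Finset.range n, ((x k : ℕ) : ℝ) * r ^ k -
        ∑ k ∈ Finset.range n, ((y k : ℕ) : ℝ) * r ^ k + digitSum r ω' := by
    intro r h0 h1
    rw [digitSum_eq_sum_add h0 h1 ω n, digitSum_eq_sum_add h0 h1 ω' n, hshift,
      Finset.sum_congr rfl fun k hk => by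
        rw [PiNat.mem_cylinder_iff.1 hω k (Finset.mem_range.1 hk)],
      Finset.sum_congr (f := fun k => ((ω' k : ℕ) : ℝ) * r ^ k) rfl fun k hk => by
        rw [PiNat.mem_cylinder_iff.1 hω' k (Finset.mem_range.1 hk)]]
    ring
  refine ⟨_, ⟨ω', hω', rfl⟩, ?_⟩
  ext j
  fin_cases j
  · exact (key γ hγ0 hγ1).symm
  · exact (key lam hl0 hl1).symm

/-- The Hausdorff measure on `K_{γ,λ}`, if finite, is a multiple of the image of the uniform
Bernoulli measure. -/
theorem hausdorffMeasure_image_coding {m : ℕ} (hm : 0 < m) {γ lam : ℝ} (hγ0 : 0 < γ)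
    (hγlam : γ < lam) (hl1 : lam < 1)
    (hsep : StrongSeparation (affineIFS m γ lam) (selfAffineSet m γ lam)) {s : ℝ}
    (hfin : Measure.hausdorffMeasure s (selfAffineSet m γ lam) ≠ ⊤) (A : Set (ℕ → Fin m)) :
    Measure.hausdorffMeasure s (coding γ lam '' A) =
      Measure.hausdorffMeasure s (selfAffineSet m γ lam) * uniformBernoulli m A := by
  have hemb := measurableEmbedding_coding (m := m) hγ0 hγlam hl1 hsep
  set κ := (Measure.hausdorffMeasure s).comap (coding γ lam : (ℕ → Fin m) → _) with hκ
  -- For a measurable embedding this holds for every set, which is why `A` need not be measurable.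
  have happ : ∀ A, κ A = Measure.hausdorffMeasure s (coding γ lam '' A) :=
    fun A => hemb.comap_apply _ A
  have huniv : κ univ = Measure.hausdorffMeasure s (selfAffineSet m γ lam) := by
    rw [happ, image_univ, range_coding]
  have : IsFiniteMeasure κ := ⟨by rw [huniv]; exact hfin.lt_top⟩
  have hle := fun x y n => hausdorffMeasure_image_cylinder_le (m := m) hγ0.le
    (hγlam.trans hl1) (hγ0.trans hγlam).le hl1 s x y n
  have h := eq_smul_uniformBernoulli hm (κ := κ) fun x y n => by
    rw [happ, happ]
    exact le_antisymm (hle x y n) (hle y x n)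
  rw [← happ, ← huniv, ← smul_eq_mul, ← Measure.smul_apply, ← h]

/-! ### Bounded densities -/

theorem IsACWithBoundedDensity.exists_le_smul {ν : Measure ℝ} [IsFiniteMeasure ν]
    (h : IsACWithBoundedDensity ν) : ∃ C : NNReal, ν ≤ C • (volume : Measure ℝ) := by
  obtain ⟨hac, C, hC⟩ := h
  refine ⟨C, Measure.le_iff.2 fun A hA => ?_⟩
  rw [← Measure.withDensity_rnDeriv_eq ν volume hac, withDensity_apply _ hA]
  calc ∫⁻ x in A, ν.rnDeriv volume x ≤ ∫⁻ _ in A, (C : ENNReal) :=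
        lintegral_mono_ae (ae_restrict_of_ae hC)
    _ = (C • (volume : Measure ℝ)) A := by
        rw [setLIntegral_const, Measure.smul_apply]; rfl

theorem isACWithBoundedDensity_of_le_smul {ν : Measure ℝ} {C : NNReal}
    (h : ν ≤ C • (volume : Measure ℝ)) : IsACWithBoundedDensity ν := by
  refine ⟨Measure.absolutelyContinuous_of_le_smul (c := (C : ENNReal)) h, C, ?_⟩
  refine ae_le_of_forall_setLIntegral_le_of_sigmaFinite (Measure.measurable_rnDeriv _ _)
    fun A hA _ => ?_
  rw [setLIntegral_const]
  exact (Measure.setLIntegral_rnDeriv_le A).trans (h A)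

/-! ### A bounded density implies positive Hausdorff measure -/

/-- Being small, `U` meets the codings of only one cylinder of length `n`. Within it the second
coordinate, rescaled by `lam^(-n)`, stays in an interval of length `2 * r / lam^n`. Independence of
the first `n` digits from the later ones multiplies the two bounds. -/
theorem uniformBernoulli_preimage_coding_le {m : ℕ} (hm : 0 < m) {γ lam : ℝ} (hγ0 : 0 < γ)
    (hγlam : γ < lam) (hl1 : lam < 1) {C : NNReal}
    (hC : bernoulliConvolution m lam ≤ C • (volume : Measure ℝ)) {d : ℝ} (hd0 : 0 < d)
    (hd : ∀ ω ω' : ℕ → Fin m, ω 0 ≠ ω' 0 → d ≤ dist (coding γ lam ω) (coding γ lam ω')) (n : ℕ)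
    (U : Set (EuclideanSpace ℝ (Fin 2))) {r : ℝ}
    (hr : ∀ p ∈ U, ∀ q ∈ U, dist p q ≤ r) (hrn : r < d * γ ^ n) :
    uniformBernoulli m (coding γ lam ⁻¹' U) ≤
      ENNReal.ofReal ((m : ℝ)⁻¹ ^ n * (C * (2 * (r / lam ^ n)))) := by
  have hl0 : 0 < lam := hγ0.trans hγlam
  rcases (coding γ lam ⁻¹' U).eq_empty_or_nonempty with hE | ⟨ω₀, h₀⟩
  · rw [hE, measure_empty]; exact zero_le
  set B := Metric.closedBall (digitSum lam (shift n ω₀)) (r / lam ^ n)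
  have hmeas : Measurable (digitSum lam : (ℕ → Fin m) → ℝ) :=
    (continuous_digitSum hl0.le hl1).measurable
  have hB : MeasurableSet B := Metric.isClosed_closedBall.measurableSet
  have hsub : coding γ lam ⁻¹' U ⊆
      PiNat.cylinder ω₀ n ∩ shift n ⁻¹' (digitSum lam ⁻¹' B) := by
    intro ω hω
    have hdist := hr _ hω _ h₀
    have hcyl := mem_cylinder_of_dist_coding_lt hγ0 hγlam hl1 hd0 hd n ω ω₀ (hdist.trans_lt hrn)
    refine ⟨hcyl, ?_⟩
    have := (abs_digitSum_sub_le_dist_coding γ lam ω ω₀).trans hdist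
    rw [digitSum_sub_of_mem_cylinder hl0.le hl1 hcyl, abs_mul, abs_of_pos (pow_pos hl0 n)] at this
    rw [mem_preimage, mem_preimage, Metric.mem_closedBall, Real.dist_eq,
      le_div_iff₀ (pow_pos hl0 n)]
    linarith
  have hpow : (m : ENNReal)⁻¹ ^ n = ENNReal.ofReal ((m : ℝ)⁻¹ ^ n) := by
    rw [ENNReal.ofReal_pow (by positivity), ENNReal.ofReal_inv_of_pos (by exact_mod_cast hm),
      ENNReal.ofReal_natCast]
  calc uniformBernoulli m (coding γ lam ⁻¹' U)
      ≤ (m : ENNReal)⁻¹ ^ n * uniformBernoulli m (digitSum lam ⁻¹' B) := by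
        rw [← uniformBernoulli_cylinder_inter_shift hm n ω₀ (hmeas hB)]
        exact measure_mono hsub
    _ = (m : ENNReal)⁻¹ ^ n * bernoulliConvolution m lam B := by
        rw [bernoulliConvolution, Measure.map_apply hmeas hB]
    _ ≤ (m : ENNReal)⁻¹ ^ n * (C * volume B) := by gcongr; exact hC B
    _ = _ := by
        rw [Real.volume_closedBall, hpow, ← ENNReal.ofReal_coe_nnreal,
          ← ENNReal.ofReal_mul (by positivity), ← ENNReal.ofReal_mul (by positivity)]

theorem hausdorffMeasure_pos_of_le_smul {m : ℕ} (hm : 0 < m) {γ lam : ℝ} (hγ0 : 0 < γ)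
    (hγlam : γ < lam) (hl1 : lam < 1)
    (hsep : StrongSeparation (affineIFS m γ lam) (selfAffineSet m γ lam)) {s : ℝ} (hs : 1 < s)
    (hcrit : m * lam * γ ^ (s - 1) = 1) {C : NNReal}
    (hC : bernoulliConvolution m lam ≤ C • (volume : Measure ℝ)) :
    0 < Measure.hausdorffMeasure s (selfAffineSet m γ lam) := by
  have hγ1 : γ < 1 := hγlam.trans hl1
  have hl0 : 0 < lam := hγ0.trans hγlam
  have hm0 : (0 : ℝ) < m := by exact_mod_cast hm
  have := isProbabilityMeasure_uniformBernoulli hm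
  have hemb := measurableEmbedding_coding (m := m) hγ0 hγlam hl1 hsep
  obtain ⟨d, hd0, hd⟩ := exists_le_dist_coding hγ0.le hγ1 hl0.le hl1 hsep
  -- The quotient comes from bounding `γ^n` by `r / (d/2 * γ)`; the summand `1` keeps `C'` positive
  -- when `C = 0`.
  set C' : ℝ := 2 * C / (d / 2 * γ) ^ (s - 1) + 1 with hC'
  have hC'0 : 0 < C' := by positivity
  have hreal : ∀ r, 0 ≤ r → r ≤ d / 2 → ∃ n : ℕ, r < d * γ ^ n ∧
      (m : ℝ)⁻¹ ^ n * (C * (2 * (r / lam ^ n))) ≤ C' * r ^ s := by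
    intro r hr0 hrd
    rcases hr0.eq_or_lt with rfl | hr0
    · exact ⟨0, by simpa using hd0, by simp; positivity⟩
    -- Thus `(d/2) * γ^(n+1) < r ≤ (d/2) * γ^n`; halving `d` makes `r < d * γ^n` strict.
    obtain ⟨n, hn1, hn2⟩ := exists_nat_pow_near_of_lt_one (x := r / (d / 2)) (y := γ)
      (by positivity) ((div_le_one (by positivity)).2 hrd) hγ0 hγ1
    rw [div_le_iff₀ (by positivity)] at hn2
    rw [lt_div_iff₀ (by positivity)] at hn1
    refine ⟨n, by nlinarith [pow_pos hγ0 n], ?_⟩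
    have h1 : (m : ℝ)⁻¹ ^ n / lam ^ n = (γ ^ n) ^ (s - 1) := by
      rw [← Real.rpow_natCast γ, ← Real.rpow_mul hγ0.le, mul_comm (n : ℝ), Real.rpow_mul hγ0.le,
        Real.rpow_natCast, eq_div_of_mul_eq (by positivity) ((mul_comm _ _).trans hcrit), div_pow,
        mul_pow, one_pow, inv_pow]
      field_simp
    have h2 : (γ ^ n) ^ (s - 1) ≤ r ^ (s - 1) / (d / 2 * γ) ^ (s - 1) := by
      rw [← Real.div_rpow hr0.le (by positivity)]
      refine Real.rpow_le_rpow (by positivity) ?_ (by linarith)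
      rw [le_div_iff₀ (by positivity)]
      rw [pow_succ] at hn1
      linarith
    calc (m : ℝ)⁻¹ ^ n * (C * (2 * (r / lam ^ n)))
        = 2 * C * r * ((m : ℝ)⁻¹ ^ n / lam ^ n) := by ring
      _ ≤ 2 * C * r * (r ^ (s - 1) / (d / 2 * γ) ^ (s - 1)) := by rw [h1]; gcongr
      _ = 2 * C / (d / 2 * γ) ^ (s - 1) * r ^ s := by
        rw [show r ^ s = r * r ^ (s - 1) by
          rw [← Real.rpow_one_add' hr0.le (by linarith)]; congr 1; ring]
        ring
      _ ≤ C' * r ^ s := by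
        have := Real.rpow_nonneg hr0.le s
        gcongr
        linarith
  -- Mass distribution principle: a measure giving each small set at most its diameter to the power
  -- `s` lies below `H^s`.
  have hle : (ENNReal.ofReal C')⁻¹ • (uniformBernoulli m).map (coding γ lam) ≤
      Measure.hausdorffMeasure s := by
    refine Measure.le_hausdorffMeasure s _ (ENNReal.ofReal (d / 2))
      (ENNReal.ofReal_pos.2 (by positivity)) fun U hU => ?_
    have htop : Metric.ediam U ≠ ⊤ := (hU.trans_lt ENNReal.ofReal_lt_top).ne
    have hr0 : 0 ≤ Metric.diam U := Metric.diam_nonneg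
    have hdiam : ENNReal.ofReal (Metric.diam U) = Metric.ediam U := ENNReal.ofReal_toReal htop
    obtain ⟨n, hn1, hn2⟩ := hreal (Metric.diam U) hr0 <| by
      rw [← hdiam] at hU
      exact (ENNReal.ofReal_le_ofReal_iff (by positivity)).1 hU
    have := uniformBernoulli_preimage_coding_le hm hγ0 hγlam hl1 hC hd0 hd n U
      (fun p hp q hq => Metric.dist_le_diam_of_mem (Metric.isBounded_iff_ediam_ne_top.2 htop) hp hq)
      hn1
    rw [Measure.smul_apply, hemb.map_apply, smul_eq_mul,
      ENNReal.inv_mul_le_iff (by simpa using hC'0) ENNReal.ofReal_ne_top]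
    refine this.trans ((ENNReal.ofReal_le_ofReal hn2).trans_eq ?_)
    rw [ENNReal.ofReal_mul hC'0.le, ← ENNReal.ofReal_rpow_of_nonneg hr0 (by linarith), hdiam]
  refine lt_of_lt_of_le ?_ (hle (selfAffineSet m γ lam))
  rw [Measure.smul_apply, hemb.map_apply, ← range_coding, preimage_range, measure_univ,
    smul_eq_mul, mul_one]
  exact ENNReal.inv_pos.2 ENNReal.ofReal_ne_top

/-! ### Positive Hausdorff measure implies a bounded density -/

theorem digitSum_mem_Icc {m : ℕ} {r : ℝ} (h0 : 0 ≤ r) (h1 : r < 1) (ω : ℕ → Fin m) :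
    digitSum r ω ∈ Icc 0 (m * (1 - r)⁻¹) := by
  refine ⟨tsum_nonneg fun k => by positivity, ?_⟩
  rw [← tsum_geometric_of_lt_one h0 h1, ← tsum_mul_left]
  refine (summable_digit h0 h1 ω).tsum_le_tsum (fun k => ?_)
    ((summable_geometric_of_lt_one h0 h1).mul_left _)
  exact (le_abs_self _).trans (norm_digit_mul_le h0 (ω k) k)

/-- The cell with index `i` of the grid of mesh `r` on the real line. -/
def cell (r : ℝ) (i : ℤ) : Set ℝ := {y | ⌊y / r⌋ = i}

theorem cell_eq_Ico {r : ℝ} (hr : 0 < r) (i : ℤ) : cell r i = Ico (i * r) ((i + 1) * r) := by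
  ext y
  simp only [cell, mem_ofPred_eq, mem_Ico, Int.floor_eq_iff, le_div_iff₀ hr, div_lt_iff₀ hr]

theorem measurableSet_cell {r : ℝ} (hr : 0 < r) (i : ℤ) : MeasurableSet (cell r i) := by
  rw [cell_eq_Ico hr]; exact measurableSet_Ico

theorem volume_cell {r : ℝ} (hr : 0 < r) (i : ℤ) : volume (cell r i) = ENNReal.ofReal r := by
  rw [cell_eq_Ico hr, Real.volume_Ico]; congr 1; ring

theorem measure_biUnion_cell {r : ℝ} (hr : 0 < r) (ν : Measure ℝ) (S : Finset ℤ) :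
    ν (⋃ i ∈ S, cell r i) = ∑ i ∈ S, ν (cell r i) :=
  measure_biUnion_finset
    (fun _ _ _ _ hij => disjoint_left.2 fun _ hi hj => hij (hi.symm.trans hj))
    fun i _ => measurableSet_cell hr i

theorem abs_sub_le_of_mem_cell {r : ℝ} (hr : 0 < r) {i : ℤ} {x y : ℝ} (hx : x ∈ cell r i)
    (hy : y ∈ cell r i) : |x - y| ≤ r := by
  have h := (Int.abs_sub_lt_one_of_floor_eq_floor (hx.trans hy.symm)).le
  rwa [← sub_div, abs_div, abs_of_pos hr, div_le_one hr] at h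

/-- The sequences `ω` for which the second coordinate of the coding of `shift n ω` lies in a cell
of mesh `(γ / lam) ^ n` with index in `S`. -/
def cellSet (m : ℕ) (γ lam : ℝ) (n : ℕ) (S : Finset ℤ) : Set (ℕ → Fin m) :=
  shift n ⁻¹' (digitSum lam ⁻¹' ⋃ i ∈ S, cell ((γ / lam) ^ n) i)

theorem mem_cellSet {m : ℕ} {γ lam : ℝ} {n : ℕ} {S : Finset ℤ} {ω : ℕ → Fin m} :
    ω ∈ cellSet m γ lam n S ↔ ⌊digitSum lam (shift n ω) / (γ / lam) ^ n⌋ ∈ S := by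
  simp [cellSet, cell]

theorem uniformBernoulli_preimage_shift {m : ℕ} (hm : 0 < m) {lam : ℝ} (hl0 : 0 ≤ lam)
    (hl1 : lam < 1) (n : ℕ) {A : Set ℝ} (hA : MeasurableSet A) :
    uniformBernoulli m (shift n ⁻¹' (digitSum lam ⁻¹' A)) = bernoulliConvolution m lam A := by
  have hd : Measurable (digitSum lam : (ℕ → Fin m) → ℝ) := (continuous_digitSum hl0 hl1).measurable
  rw [← Measure.map_apply (continuous_shift n).measurable (hd hA), map_shift_uniformBernoulli hm,
    bernoulliConvolution, Measure.map_apply hd hA]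

section

variable {m : ℕ} {γ lam : ℝ}

theorem measurableSet_biUnion_cell {r : ℝ} (hr : 0 < r) (S : Finset ℤ) :
    MeasurableSet (⋃ i ∈ S, cell r i) :=
  S.measurableSet_biUnion fun i _ => measurableSet_cell hr i

theorem uniformBernoulli_cellSet (hm : 0 < m) (hγ0 : 0 < γ) (hl0 : 0 < lam) (hl1 : lam < 1) (n : ℕ)
    (S : Finset ℤ) : uniformBernoulli m (cellSet m γ lam n S) =
      ∑ i ∈ S, bernoulliConvolution m lam (cell ((γ / lam) ^ n) i) := by
  have hr : 0 < (γ / lam) ^ n := by positivity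
  rw [cellSet, uniformBernoulli_preimage_shift hm hl0.le hl1 n (measurableSet_biUnion_cell hr S),
    measure_biUnion_cell hr]

theorem measurableSet_cellSet (hγ0 : 0 < γ) (hl0 : 0 < lam) (hl1 : lam < 1) (n : ℕ)
    (S : Finset ℤ) : MeasurableSet (cellSet m γ lam n S) :=
  (continuous_shift n).measurable ((continuous_digitSum hl0.le hl1).measurable
    (measurableSet_biUnion_cell (by positivity) S))

/-! ### Covers by approximate squares and finiteness of the Hausdorff measure -/

/-- The mesh is chosen so that `lam^n * (γ/lam)^n = γ^n`: fixing `n` digits and one cell leaves a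
piece of comparable width and height. -/
theorem dist_coding_le (hγ0 : 0 < γ) (hγlam : γ < lam) (hl1 : lam < 1) {n : ℕ} {i : ℤ}
    {ω ω' : ℕ → Fin m} (hcyl : ω ∈ PiNat.cylinder ω' n)
    (hω : digitSum lam (shift n ω) ∈ cell ((γ / lam) ^ n) i)
    (hω' : digitSum lam (shift n ω') ∈ cell ((γ / lam) ^ n) i) :
    dist (coding γ lam ω) (coding γ lam ω') ≤ (m * (1 - γ)⁻¹ + 1) * γ ^ n := by
  have hγ1 : γ < 1 := hγlam.trans hl1
  have hl0 : 0 < lam := hγ0.trans hγlam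
  have h1 : |digitSum γ ω - digitSum γ ω'| ≤ m * (1 - γ)⁻¹ * γ ^ n := by
    rw [digitSum_sub_of_mem_cylinder hγ0.le hγ1 hcyl, abs_mul, abs_of_pos (pow_pos hγ0 n), mul_comm]
    have a := digitSum_mem_Icc hγ0.le hγ1 (shift n ω)
    have b := digitSum_mem_Icc hγ0.le hγ1 (shift n ω')
    gcongr
    exact abs_sub_le_iff.2 ⟨by linarith [a.2, b.1], by linarith [b.2, a.1]⟩
  have h2 : |digitSum lam ω - digitSum lam ω'| ≤ γ ^ n := by
    rw [digitSum_sub_of_mem_cylinder hl0.le hl1 hcyl, abs_mul, abs_of_pos (pow_pos hl0 n)]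
    calc lam ^ n * _ ≤ lam ^ n * (γ / lam) ^ n := by
          gcongr
          exact abs_sub_le_of_mem_cell (by positivity) hω hω'
      _ = γ ^ n := by rw [← mul_pow, mul_div_cancel₀ _ hl0.ne']
  have hsum : |digitSum γ ω - digitSum γ ω'| + |digitSum lam ω - digitSum lam ω'| ≤
      (m * (1 - γ)⁻¹ + 1) * γ ^ n := by linarith
  rw [dist_coding]
  refine Real.sqrt_le_iff.2 ⟨(add_nonneg (abs_nonneg _) (abs_nonneg _)).trans hsum, ?_⟩
  refine le_trans ?_ (pow_le_pow_left₀ (add_nonneg (abs_nonneg _) (abs_nonneg _)) hsum 2)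
  rw [← sq_abs, ← sq_abs (digitSum lam ω - digitSum lam ω')]
  nlinarith [mul_nonneg (abs_nonneg (digitSum γ ω - digitSum γ ω'))
    (abs_nonneg (digitSum lam ω - digitSum lam ω'))]

/-- The pre-measures at scale `δ` that define the Hausdorff measure. -/
def hausdorffPre (s : ℝ) (δ : ENNReal) : OuterMeasure (EuclideanSpace ℝ (Fin 2)) :=
  OuterMeasure.mkMetric'.pre (fun U => Metric.ediam U ^ s) δ

theorem hausdorffPre_le {s : ℝ} {δ : ENNReal} (hδ : 0 < δ) (U : Set (EuclideanSpace ℝ (Fin 2))) :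
    hausdorffPre s δ U ≤ Measure.hausdorffMeasure s U := by
  rw [Measure.hausdorffMeasure, ← OuterMeasure.coe_mkMetric]
  exact (le_iSup₂ (f := fun (r : ENNReal) (_ : 0 < r) =>
    OuterMeasure.mkMetric'.pre (fun U => Metric.ediam U ^ s) r) δ hδ :
      hausdorffPre s δ ≤ _) U

theorem tendsto_hausdorffPre {s : ℝ} {D : ℝ} (hD : 0 < D) (hγ0 : 0 < γ) (hγ1 : γ < 1)
    (U : Set (EuclideanSpace ℝ (Fin 2))) :
    Filter.Tendsto (fun n : ℕ => hausdorffPre s (ENNReal.ofReal (D * γ ^ n)) U) Filter.atTop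
      (nhds (Measure.hausdorffMeasure s U)) := by
  rw [Measure.hausdorffMeasure, ← OuterMeasure.coe_mkMetric]
  refine (OuterMeasure.mkMetric'.tendsto_pre (fun U => Metric.ediam U ^ s) U).comp
    (tendsto_nhdsWithin_iff.2 ⟨?_, Filter.Eventually.of_forall fun n =>
      ENNReal.ofReal_pos.2 (by positivity)⟩)
  have := (tendsto_pow_atTop_nhds_zero_of_lt_one hγ0.le hγ1).const_mul D
  rw [mul_zero] at this
  simpa using ENNReal.tendsto_ofReal this

theorem hausdorffPre_image_cellSet_le (hγ0 : 0 < γ) (hγlam : γ < lam)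
    (hl1 : lam < 1) {s : ℝ} (hs : 0 ≤ s) (hcrit : m * γ ^ s = γ / lam) (n : ℕ) (S : Finset ℤ)
    {D : ℝ} (hD : D = m * (1 - γ)⁻¹ + 1) :
    hausdorffPre s (ENNReal.ofReal (D * γ ^ n)) (coding γ lam '' cellSet m γ lam n S) ≤
      ENNReal.ofReal (D ^ s) * (S.card * ENNReal.ofReal ((γ / lam) ^ n)) := by
  have hγ1 : γ < 1 := hγlam.trans hl1
  have hl0 : 0 < lam := hγ0.trans hγlam
  have hD0 : 0 < D := by
    have : 0 < (1 - γ)⁻¹ := inv_pos.2 (by linarith)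
    rw [hD]; positivity
  set piece : (Fin n → Fin m) × ℤ → Set (EuclideanSpace ℝ (Fin 2)) := fun p =>
    coding γ lam '' {ω | (∀ k : Fin n, ω k = p.1 k) ∧
      digitSum lam (shift n ω) ∈ cell ((γ / lam) ^ n) p.2} with hpiece
  have hcover : coding γ lam '' cellSet m γ lam n S ⊆
      ⋃ p ∈ (Finset.univ : Finset (Fin n → Fin m)) ×ˢ S, piece p := by
    rintro _ ⟨ω, hω, rfl⟩
    refine mem_biUnion (x := (fun k : Fin n => ω k, _)) ?_ ⟨ω, ⟨fun _ => rfl, rfl⟩, rfl⟩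
    simpa using mem_cellSet.1 hω
  have hpd : ∀ p, Metric.ediam (piece p) ≤ ENNReal.ofReal (D * γ ^ n) := by
    rintro ⟨w, i⟩
    refine Metric.ediam_le ?_
    rintro _ ⟨ω, hω, rfl⟩ _ ⟨ω', hω', rfl⟩
    rw [edist_dist, hD]
    refine ENNReal.ofReal_le_ofReal (dist_coding_le hγ0 hγlam hl1 ?_ hω.2 hω'.2)
    exact PiNat.mem_cylinder_iff.2 fun k hk => (hω.1 ⟨k, hk⟩).trans (hω'.1 ⟨k, hk⟩).symm
  -- The `m^n` pieces over a single cell cost together `D^s` times the length of that cell: this is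
  -- where `s` is critical.
  have hval : (m : ENNReal) ^ n * ENNReal.ofReal (D * γ ^ n) ^ s =
      ENNReal.ofReal (D ^ s) * ENNReal.ofReal ((γ / lam) ^ n) := by
    rw [ENNReal.ofReal_rpow_of_nonneg (by positivity) hs, ← ENNReal.ofReal_natCast,
      ← ENNReal.ofReal_pow (by positivity), ← ENNReal.ofReal_mul (by positivity),
      ← ENNReal.ofReal_mul (by positivity), Real.mul_rpow hD0.le (by positivity), ← hcrit, mul_pow,
      ← Real.rpow_natCast γ, ← Real.rpow_mul hγ0.le, mul_comm (n : ℝ) s, Real.rpow_mul hγ0.le,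
      Real.rpow_natCast]
    congr 1
    ring
  calc hausdorffPre s (ENNReal.ofReal (D * γ ^ n)) (coding γ lam '' cellSet m γ lam n S)
      ≤ ∑ p ∈ (Finset.univ : Finset (Fin n → Fin m)) ×ˢ S,
          hausdorffPre s (ENNReal.ofReal (D * γ ^ n)) (piece p) :=
        (measure_mono hcover).trans (measure_biUnion_finset_le _ _)
    _ ≤ ∑ p ∈ (Finset.univ : Finset (Fin n → Fin m)) ×ˢ S, ENNReal.ofReal (D * γ ^ n) ^ s :=
        Finset.sum_le_sum fun p _ => (OuterMeasure.mkMetric'.pre_le (hpd p)).trans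
          (ENNReal.rpow_le_rpow (hpd p) hs)
    _ = S.card * ((m : ENNReal) ^ n * ENNReal.ofReal (D * γ ^ n) ^ s) := by
        simp [Finset.card_product]
        ring
    _ = _ := by rw [hval]; ring

/-- The indices of the cells of mesh `(γ / lam) ^ n` that can meet the support of the Bernoulli
convolution. -/
def cellIndices (m : ℕ) (γ lam : ℝ) (n : ℕ) : Finset ℤ :=
  Finset.Icc 0 ⌊m * (1 - lam)⁻¹ / (γ / lam) ^ n⌋

theorem floor_mem_cellIndices (hγ0 : 0 < γ) (hl0 : 0 < lam) (hl1 : lam < 1) (n : ℕ)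
    (ω : ℕ → Fin m) :
    ⌊digitSum lam (shift n ω) / (γ / lam) ^ n⌋ ∈ cellIndices m γ lam n := by
  have h := digitSum_mem_Icc hl0.le hl1 (shift n ω)
  have hr : 0 < (γ / lam) ^ n := by positivity
  exact Finset.mem_Icc.2 ⟨Int.floor_nonneg.2 (div_nonneg h.1 hr.le),
    Int.floor_le_floor (div_le_div_of_nonneg_right h.2 hr.le)⟩

theorem card_cellIndices_mul_le (hγ0 : 0 < γ) (hγlam : γ < lam) (hl1 : lam < 1) (n : ℕ) :
    (cellIndices m γ lam n).card * ENNReal.ofReal ((γ / lam) ^ n) ≤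
      ENNReal.ofReal (m * (1 - lam)⁻¹ + 1) := by
  have hl0 : 0 < lam := hγ0.trans hγlam
  have hr : 0 < (γ / lam) ^ n := by positivity
  have hr1 : (γ / lam) ^ n ≤ 1 := pow_le_one₀ (by positivity) ((div_le_one hl0).2 hγlam.le)
  have hY : 0 ≤ m * (1 - lam)⁻¹ := mul_nonneg (by positivity) (inv_nonneg.2 (by linarith))
  rw [← ENNReal.ofReal_natCast, ← ENNReal.ofReal_mul (by positivity)]
  refine ENNReal.ofReal_le_ofReal ?_
  have hfl := Int.floor_nonneg.2 (div_nonneg hY hr.le)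
  have hcard : ((cellIndices m γ lam n).card : ℝ) =
      (⌊m * (1 - lam)⁻¹ / (γ / lam) ^ n⌋ : ℝ) + 1 := by
    rw [cellIndices, Int.card_Icc, sub_zero]
    have : (((⌊m * (1 - lam)⁻¹ / (γ / lam) ^ n⌋ + 1).toNat : ℤ) : ℝ) =
        ((⌊m * (1 - lam)⁻¹ / (γ / lam) ^ n⌋ + 1 : ℤ) : ℝ) := by
      rw [Int.toNat_of_nonneg (by omega)]
    exact_mod_cast this
  have hle := Int.floor_le (m * (1 - lam)⁻¹ / (γ / lam) ^ n)
  rw [le_div_iff₀ hr] at hle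
  rw [hcard, add_mul, one_mul]
  exact add_le_add hle hr1

/-- Taking all cells that can occur bounds every pre-measure by `D^s` times a bounded total length.
-/
theorem hausdorffMeasure_selfAffineSet_ne_top (hγ0 : 0 < γ) (hγlam : γ < lam) (hl1 : lam < 1)
    {s : ℝ} (hs : 0 ≤ s) (hcrit : m * γ ^ s = γ / lam) :
    Measure.hausdorffMeasure s (selfAffineSet m γ lam) ≠ ⊤ := by
  have hγ1 : γ < 1 := hγlam.trans hl1
  have hD : 0 < m * (1 - γ)⁻¹ + 1 := by
    have : 0 < (1 - γ)⁻¹ := inv_pos.2 (by linarith)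
    positivity
  refine ne_top_of_le_ne_top (b := ENNReal.ofReal ((m * (1 - γ)⁻¹ + 1) ^ s) *
    ENNReal.ofReal (m * (1 - lam)⁻¹ + 1)) (by finiteness)
    (le_of_tendsto' (tendsto_hausdorffPre hD hγ0 hγ1 _) fun n => ?_)
  have huniv : cellSet m γ lam n (cellIndices m γ lam n) = univ :=
    eq_univ_of_forall fun ω =>
      mem_cellSet.2 (floor_mem_cellIndices hγ0 (hγ0.trans hγlam) hl1 n ω)
  have := hausdorffPre_image_cellSet_le (m := m) hγ0 hγlam hl1 hs hcrit n
    (cellIndices m γ lam n) rfl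
  rw [huniv, image_univ, range_coding] at this
  exact this.trans (by gcongr; exact card_cellIndices_mul_le hγ0 hγlam hl1 n)

/-! ### Cells of large average density -/

open Classical in
/-- The indices of the cells of mesh `(γ / lam) ^ n` on which the Bernoulli convolution has average
density larger than `C`. -/
def denseIndices (m : ℕ) (γ lam : ℝ) (C : NNReal) (n : ℕ) : Finset ℤ :=
  (cellIndices m γ lam n).filter fun i =>
    C * ENNReal.ofReal ((γ / lam) ^ n) < bernoulliConvolution m lam (cell ((γ / lam) ^ n) i)

/-- Were the dense cells to keep mass, covering them economically would hold the pre-measures of `K`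
away from their limit `H^s(K)`. The choice of `C` makes that cover cost at most half of the
Hausdorff measure it replaces. -/
theorem tendsto_uniformBernoulli_cellSet_denseIndices (hm : 0 < m) (hγ0 : 0 < γ) (hγlam : γ < lam)
    (hl1 : lam < 1) (hsep : StrongSeparation (affineIFS m γ lam) (selfAffineSet m γ lam)) {s : ℝ}
    (hs : 0 ≤ s) (hcrit : m * γ ^ s = γ / lam)
    (hpos : 0 < Measure.hausdorffMeasure s (selfAffineSet m γ lam)) {C : NNReal}
    (hC : ENNReal.ofReal ((m * (1 - γ)⁻¹ + 1) ^ s) =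
      Measure.hausdorffMeasure s (selfAffineSet m γ lam) / 2 * C) :
    Filter.Tendsto (fun n => uniformBernoulli m (cellSet m γ lam n (denseIndices m γ lam C n)))
      Filter.atTop (nhds 0) := by
  have hγ1 : γ < 1 := hγlam.trans hl1
  have hl0 : 0 < lam := hγ0.trans hγlam
  have := isProbabilityMeasure_uniformBernoulli hm
  have hD : 0 < m * (1 - γ)⁻¹ + 1 := by
    have : 0 < (1 - γ)⁻¹ := inv_pos.2 (by linarith)
    positivity
  have hfin := hausdorffMeasure_selfAffineSet_ne_top (m := m) hγ0 hγlam hl1 hs hcrit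
  have himage := hausdorffMeasure_image_coding hm hγ0 hγlam hl1 hsep hfin
  have hlim := tendsto_hausdorffPre (s := s) hD hγ0 hγ1 (selfAffineSet m γ lam)
  set h := Measure.hausdorffMeasure s (selfAffineSet m γ lam) with hh
  set p : ℕ → ENNReal := fun n =>
    hausdorffPre s (ENNReal.ofReal ((m * (1 - γ)⁻¹ + 1) * γ ^ n)) (selfAffineSet m γ lam) with hp
  set E : ℕ → Set (ℕ → Fin m) := fun n => cellSet m γ lam n (denseIndices m γ lam C n) with hE
  have hcard : ∀ n, C * ((denseIndices m γ lam C n).card * ENNReal.ofReal ((γ / lam) ^ n)) ≤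
      uniformBernoulli m (E n) := by
    intro n
    rw [hE, uniformBernoulli_cellSet hm hγ0 hl0 hl1, mul_left_comm, ← nsmul_eq_mul]
    exact Finset.card_nsmul_le_sum _ _ _ fun i hi => (Finset.mem_filter.1 hi).2.le
  have hmain : ∀ n, p n + h / 2 * uniformBernoulli m (E n) ≤ h := by
    intro n
    -- The dense part is bounded by its explicit cover, the rest by its Hausdorff measure `h * μ((E
    -- n)ᶜ)`.
    have h1 : p n ≤ h / 2 * uniformBernoulli m (E n) + h * uniformBernoulli m (E n)ᶜ := by
      calc p n ≤ _ := by
            rw [hp, ← range_coding, ← image_univ, ← union_compl_self (E n), image_union]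
            exact measure_union_le _ _
        _ ≤ _ := add_le_add ((hausdorffPre_image_cellSet_le hγ0 hγlam hl1 hs hcrit n _ rfl).trans
              (by rw [hC, mul_assoc]; exact mul_le_mul_right (hcard n) _))
            ((hausdorffPre_le (ENNReal.ofReal_pos.2 (by positivity)) _).trans (himage _).le)
    calc p n + h / 2 * uniformBernoulli m (E n)
        ≤ h / 2 * uniformBernoulli m (E n) + h * uniformBernoulli m (E n)ᶜ +
          h / 2 * uniformBernoulli m (E n) := add_le_add_left h1 _
      _ = (h / 2 + h / 2) * uniformBernoulli m (E n) + h * uniformBernoulli m (E n)ᶜ := by ring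
      _ = h := by
        rw [ENNReal.add_halves, ← mul_add,
          prob_add_prob_compl (measurableSet_cellSet hγ0 hl0 hl1 _ _), mul_one]
  have hsub : Filter.Tendsto (fun n => h - p n) Filter.atTop (nhds 0) := by
    simpa using ENNReal.Tendsto.sub tendsto_const_nhds hlim (Or.inl hfin)
  have h2 : h / 2 ≠ 0 := by simpa using hpos.ne'
  have h3 : h / 2 ≠ ⊤ := ENNReal.div_ne_top hfin (by simp)
  have hz : Filter.Tendsto (fun n => (h / 2)⁻¹ * (h - p n)) Filter.atTop (nhds 0) := by
    simpa using ENNReal.Tendsto.const_mul hsub (Or.inr (ENNReal.inv_ne_top.2 h2))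
  refine tendsto_of_tendsto_of_tendsto_of_le_of_le tendsto_const_nhds hz (fun n => zero_le)
    fun n => ?_
  have h4 : h / 2 * uniformBernoulli m (E n) ≤ h - p n :=
    ENNReal.le_sub_of_add_le_left (ne_top_of_le_ne_top hfin (le_self_add.trans (hmain n))) (hmain n)
  calc uniformBernoulli m (E n) = (h / 2)⁻¹ * (h / 2 * uniformBernoulli m (E n)) := by
        rw [← mul_assoc, ENNReal.inv_mul_cancel h2 h3, one_mul]
    _ ≤ _ := mul_le_mul_right h4 _

/-- A cell that is not dense has mass at most `C` times its length, and the cells meeting `A` lie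
within one mesh width of `A`. -/
theorem bernoulliConvolution_le_add (hm : 0 < m) (hγ0 : 0 < γ) (hγlam : γ < lam)
    (hl1 : lam < 1) (C : NNReal) {A : Set ℝ} (hA : MeasurableSet A) (n : ℕ) :
    bernoulliConvolution m lam A ≤
      uniformBernoulli m (cellSet m γ lam n (denseIndices m γ lam C n)) +
        C * volume (Metric.cthickening ((γ / lam) ^ n) A) := by
  classical
  have hl0 : 0 < lam := hγ0.trans hγlam
  have hr : 0 < (γ / lam) ^ n := by positivity
  set T := (cellIndices m γ lam n).filter fun i =>
    i ∉ denseIndices m γ lam C n ∧ (cell ((γ / lam) ^ n) i ∩ A).Nonempty with hT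
  have hsub : shift n ⁻¹' (digitSum lam ⁻¹' A) ⊆
      cellSet m γ lam n (denseIndices m γ lam C n) ∪ cellSet m γ lam n T := by
    intro ω hω
    by_cases hd : ω ∈ cellSet m γ lam n (denseIndices m γ lam C n)
    · exact Or.inl hd
    · exact Or.inr (mem_cellSet.2 (Finset.mem_filter.2 ⟨floor_mem_cellIndices hγ0 hl0 hl1 n ω,
        fun h => hd (mem_cellSet.2 h), _, rfl, hω⟩))
  have hTle : uniformBernoulli m (cellSet m γ lam n T) ≤
      C * volume (Metric.cthickening ((γ / lam) ^ n) A) := by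
    calc uniformBernoulli m (cellSet m γ lam n T)
        = ∑ i ∈ T, bernoulliConvolution m lam (cell ((γ / lam) ^ n) i) :=
          uniformBernoulli_cellSet hm hγ0 hl0 hl1 n T
      _ ≤ ∑ i ∈ T, C * volume (cell ((γ / lam) ^ n) i) := Finset.sum_le_sum fun i hi => by
          have hi := Finset.mem_filter.1 hi
          rw [volume_cell hr]
          by_contra! hlt
          exact hi.2.1 (Finset.mem_filter.2 ⟨hi.1, hlt⟩)
      _ = C * volume (⋃ i ∈ T, cell ((γ / lam) ^ n) i) := by
          rw [← Finset.mul_sum, measure_biUnion_cell hr]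
      _ ≤ _ := by
          gcongr
          refine iUnion₂_subset fun i hi y hy => ?_
          obtain ⟨z, hz, hzA⟩ := (Finset.mem_filter.1 hi).2.2
          exact Metric.mem_cthickening_of_dist_le y z _ A hzA (abs_sub_le_of_mem_cell hr hy hz)
  rw [← uniformBernoulli_preimage_shift hm hl0.le hl1 n hA]
  exact (measure_mono hsub).trans ((measure_union_le _ _).trans (add_le_add_right hTle _))

theorem exists_bernoulliConvolution_le_smul (hm : 0 < m) (hγ0 : 0 < γ) (hγlam : γ < lam)
    (hl1 : lam < 1) (hsep : StrongSeparation (affineIFS m γ lam) (selfAffineSet m γ lam)) {s : ℝ}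
    (hs : 0 ≤ s) (hcrit : m * γ ^ s = γ / lam)
    (hpos : 0 < Measure.hausdorffMeasure s (selfAffineSet m γ lam)) :
    ∃ C : NNReal, bernoulliConvolution m lam ≤ C • (volume : Measure ℝ) := by
  have hl0 : 0 < lam := hγ0.trans hγlam
  have := isProbabilityMeasure_bernoulliConvolution hm hl0.le hl1
  have hfin := hausdorffMeasure_selfAffineSet_ne_top (m := m) hγ0 hγlam hl1 hs hcrit
  set h := Measure.hausdorffMeasure s (selfAffineSet m γ lam) with hh
  have h2 : h / 2 ≠ 0 := by simpa using hpos.ne'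
  have h3 : h / 2 ≠ ⊤ := ENNReal.div_ne_top hfin (by simp)
  set C : NNReal := (ENNReal.ofReal ((m * (1 - γ)⁻¹ + 1) ^ s) / (h / 2)).toNNReal with hCdef
  have hC : ENNReal.ofReal ((m * (1 - γ)⁻¹ + 1) ^ s) = h / 2 * C := by
    rw [hCdef, ENNReal.coe_toNNReal (ENNReal.div_ne_top ENNReal.ofReal_ne_top h2),
      ENNReal.mul_div_cancel h2 h3]
  have hlim := tendsto_uniformBernoulli_cellSet_denseIndices hm hγ0 hγlam hl1 hsep hs hcrit hpos hC
  refine ⟨C, Measure.le_iff.2 fun A hA => ?_⟩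
  by_contra! hlt
  -- Compactness is needed for the volumes of the shrinking thickenings to tend to the volume of the
  -- set itself.
  obtain ⟨B, hBA, hB, hBlt⟩ := hA.exists_lt_isCompact hlt
  refine hBlt.not_ge (le_trans ?_ (measure_mono hBA))
  have hthick : Filter.Tendsto (fun n : ℕ => volume (Metric.cthickening ((γ / lam) ^ n) B))
      Filter.atTop (nhds (volume B)) :=
    (tendsto_measure_cthickening_of_isCompact hB).comp (tendsto_pow_atTop_nhds_zero_of_lt_one
      (by positivity) ((div_lt_one hl0).2 hγlam))
  have hsum := hlim.add (ENNReal.Tendsto.const_mul (a := (C : ENNReal)) hthick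
    (Or.inr ENNReal.coe_ne_top))
  rw [zero_add] at hsum
  exact ge_of_tendsto' hsum fun n =>
    bernoulliConvolution_le_add hm hγ0 hγlam hl1 C hB.measurableSet n

end

end

/-! ### The equivalence -/

theorem mainTheorem10 (m : ℕ) (hm : 2 ≤ m) (γ lam : ℝ) (hγ : 0 < γ) (hγlam : γ < lam)
    (hlam : lam < 1) (hlarge : 1 / (m : ℝ) < lam) (hprod : γ * lam < 1 / (m : ℝ))
    (hsep : StrongSeparation (affineIFS m γ lam) (selfAffineSet m γ lam)) :
    0 < Measure.hausdorffMeasure (falconerDimension fun _ : Fin m => diagMap γ lam)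
        (selfAffineSet m γ lam) ↔
      IsACWithBoundedDensity (bernoulliConvolution m lam) := by
  have hm0 : 0 < m := by omega
  have hm0' : (0 : ℝ) < m := by exact_mod_cast hm0
  have hl0 : 0 < lam := hγ.trans hγlam
  have hlarge' : 1 < m * lam := by rwa [div_lt_iff₀ hm0', mul_comm] at hlarge
  have hprod' : m * lam * γ < 1 := by
    rw [lt_div_iff₀ hm0'] at hprod
    linarith
  have hs1 := one_lt_criticalExponent hγ (hγlam.trans hlam) hlarge'
  have hcrit := mul_rpow_criticalExponent hγ (hγlam.trans hlam) (zero_lt_one.trans hlarge')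
  -- The critical equation in the form suited to covers: passing to the next level multiplies the
  -- cost over one cell by the ratio of successive meshes.
  have hcrit' : m * γ ^ criticalExponent m γ lam = γ / lam := by
    rw [Real.rpow_sub_one hγ.ne'] at hcrit
    field_simp at hcrit ⊢
    linarith
  rw [falconerDimension_diagMap hγ hγlam hlam hlarge' hprod']
  have := isProbabilityMeasure_bernoulliConvolution hm0 hl0.le hlam
  constructor
  · intro hpos
    obtain ⟨C, hC⟩ := exists_bernoulliConvolution_le_smul hm0 hγ hγlam hlam hsep
      (by linarith) hcrit' hpos
    exact isACWithBoundedDensity_of_le_smul hC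
  · intro hac
    obtain ⟨C, hC⟩ := hac.exists_le_smul
    exact hausdorffMeasure_pos_of_le_smul hm0 hγ hγlam hlam hsep hs1 hcrit hC
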